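/- **Definitions.** A *hypergraph grammar* consists of a finite set of non-terminal symbols with arities, finite sets of arc labels (terminals of arity two) and of colours (terminals of arity one), a start symbol $Z$ of arity $0$, and exactly one rule $(H_A,\iota_A)$ for each non-terminal $A$. Here $H_A$ is a finite set of hyperarcs of positive arity labelled by these symbols (a non-terminal hyperarc having pairwise distinct vertices), and $\iota_A$ is an injection from the positions of $A$ to the vertices of $H_A$. A complete parallel rewriting step replaces simultaneously each non-terminal hyperarc $A v_1\cdots v_p$ by a copy of $H_A$ in which $\iota_A(i)$ is identified with $v_i$ and all other vertices are new. The generated graph is the union of the arcs and colours of the hypergraphs $H_0=Z, H_1, H_2,\dots$ obtained by iterating such steps; it is unique up to isomorphism. A *probabilistic hypergraph grammar* $\mathcal P$ is a hypergraph grammar with a map $\mu$ from arc labels to $\mathbb Q\cap[0,1]$ such that each vertex of the generated graph has finitely many outgoing arcs and the sum of their $\mu$-values is $1$. It induces a Markov chain $\mathcal M_{\mathcal P}$ on the vertices of the generated graph: the probability of moving from $s$ to $t$ is the sum of the $\mu$-values of the arcs from $s$ to $t$. PCTL formulae are given by $$\varphi ::= \mathtt{tt}\mid a\mid \neg\varphi\mid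 \varphi\wedge\varphi\mid \mathsf X^{\sim\rho}\varphi\mid \varphi\,\mathsf U^{\sim\rho}\varphi,\qquad {\sim}\in\{\le,<,>,\ge\},\ \rho\in\mathbb Q\cap[0,1],$$ where the atoms $a$ are the colours of $\mathcal P$. A vertex satisfies $a$ if it has the colour $a$; it satisfies $\mathsf X^{\sim\rho}\varphi$ (respectively $\varphi\,\mathsf U^{\sim\rho}\psi$) if the probability $p$ of the set of infinite paths of $\mathcal M_{\mathcal P}$ from it whose second state satisfies $\varphi$ (respectively which reach a state that satisfies $\psi$ after visiting only states that satisfy $\varphi$) has $p\sim\rho$. The other cases are as usual. **Theorem.** The exact quantitative PCTL model-checking problem for probabilistic hypergraph grammars is undecidable: there is no algorithm which, given a probabilistic hypergraph grammar $\mathcal P$ and a PCTL formula $\varphi$, decides whether $\varphi$ is valid on $\mathcal M_{\mathcal P}$. This holds for each of the following three meanings of "valid on $\mathcal M_{\mathcal P}$": 1. every vertex of $\mathcal M_{\mathcal P}$ satisfies $\varphi$; 2. some vertex of $\mathcal M_{\mathcal P}$ satisfies $\varphi$; 3. a given initial vertex $v_0$ satisfies $\varphi$, where $v_0$ is a vertex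 of $H_Z$ (part of the input) whose image is a vertex of the generated graph. -/

import Mathlib

open MeasureTheory ProbabilityTheory
open scoped ENNReal

namespace ProbHypergraph

/-! ## Hypergraphs -/

/-- Hyperarcs over the vertex set `V`: a non-terminal symbol applied to a tuple of vertices, an arc
(a terminal of arity two with a source and a target), or a colour (a terminal of arity one). -/
inductive Hyperarc (N L C V : Type) : Type
  | nonterm (A : N) (w : List V)
  | arc (a : L) (s t : V)
  | colour (c : C) (v : V)

namespace Hyperarc

variable {N L C V W : Type}

/-- The vertices that occur in a hyperarc. -/
def verts : Hyperarc N L C V → List V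
  | nonterm _ w => w
  | arc _ s t => [s, t]
  | colour _ v => [v]

/-- Renaming of the vertices of a hyperarc. -/
def map (h : V → W) : Hyperarc N L C V → Hyperarc N L C W
  | nonterm A w => nonterm A (w.map h)
  | arc a s t => arc a (h s) (h t)
  | colour c v => colour c (h v)

/-- Terminal hyperarcs are the arcs and the colours. -/
def IsTerminal : Hyperarc N L C V → Prop
  | nonterm _ _ => False
  | arc _ _ _ => True
  | colour _ _ => True

end Hyperarc

/-- The vertex set of a hypergraph: the vertices that occur in some hyperarc. -/
def vertexSet {N L C V : Type} (M : Set (Hyperarc N L C V)) : Set V :=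
  {v | ∃ e ∈ M, v ∈ e.verts}

/-- The set `[M]` of the terminal arcs and colours of a hypergraph. -/
def terminalPart {N L C V : Type} (M : Set (Hyperarc N L C V)) : Set (Hyperarc N L C V) :=
  {e ∈ M | e.IsTerminal}

/-! ## Hypergraph grammars -/

/-- Hypergraph grammars. The non-terminals, the arc labels and the colours are the elements of three
finite alphabets. Each non-terminal `A` has exactly one rule: the finite hypergraph `rhs A` (listed
by its hyperarcs, vertices being named by natural numbers), and the repetition-free list `inputs A`
of its input vertices, one for each position of a hyperarc labelled `A`. -/
structure HRGrammar where
  numNonterm : ℕ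
  numLabels : ℕ
  numColours : ℕ
  /-- the arity of a non-terminal -/
  rank : Fin numNonterm → ℕ
  /-- the start symbol, of arity zero -/
  start : Fin numNonterm
  rank_start : rank start = 0
  rhs : Fin numNonterm → List (Hyperarc (Fin numNonterm) (Fin numLabels) (Fin numColours) ℕ)
  inputs : Fin numNonterm → List ℕ
  length_inputs : ∀ A, (inputs A).length = rank A
  nodup_inputs : ∀ A, (inputs A).Nodup
  inputs_mem : ∀ A, ∀ x ∈ inputs A, x ∈ vertexSet {e | e ∈ rhs A}
  /-- Hyperarcs have the right number of vertices, which is positive, and a non-terminal hyperarc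
  has pairwise distinct vertices: otherwise no injective map could rewrite it. -/
  rhs_wf : ∀ A B w, Hyperarc.nonterm B w ∈ rhs A → w.length = rank B ∧ w ≠ [] ∧ w.Nodup

namespace HRGrammar

variable (G : HRGrammar)

/-- Hypergraphs labelled by the symbols of the grammar, with natural numbers as vertices. -/
abbrev Hypergraph : Type :=
  Set (Hyperarc (Fin G.numNonterm) (Fin G.numLabels) (Fin G.numColours) ℕ)

/-- The hypergraph on the right-hand side of the rule of `A`. -/
def ruleGraph (A : Fin G.numNonterm) : G.Hypergraph := {e | e ∈ G.rhs A}

/-- The vertices of a right-hand side that are not inputs. -/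
def newVertices (A : Fin G.numNonterm) : Set ℕ :=
  {x | x ∈ vertexSet (G.ruleGraph A) ∧ x ∉ G.inputs A}

/-- `M'` is obtained from `M` by one complete parallel rewriting step: every non-terminal hyperarc
`A w` of `M` is replaced by the image of the right-hand side of `A` under the map `h A w`, which
is injective, maps the inputs to `w`, and maps the other vertices to vertices outside `M`; distinct
hyperarcs create distinct vertices. -/
structure Rewrites (M M' : G.Hypergraph) (h : Fin G.numNonterm → List ℕ → ℕ → ℕ) : Prop where
  map_inputs : ∀ A w, Hyperarc.nonterm A w ∈ M → (G.inputs A).map (h A w) = w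
  injOn : ∀ A w, Hyperarc.nonterm A w ∈ M → Set.InjOn (h A w) (vertexSet (G.ruleGraph A))
  fresh : ∀ A w, Hyperarc.nonterm A w ∈ M → ∀ x ∈ G.newVertices A, h A w x ∉ vertexSet M
  disjoint : ∀ A w, Hyperarc.nonterm A w ∈ M → ∀ B u, Hyperarc.nonterm B u ∈ M →
    (A, w) ≠ (B, u) → ∀ x ∈ G.newVertices A, ∀ y ∈ G.newVertices B, h A w x ≠ h B u y
  result : M' = terminalPart M ∪
    {e | ∃ A w, Hyperarc.nonterm A w ∈ M ∧ ∃ r ∈ G.ruleGraph A, e = r.map (h A w)}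

/-- The hypergraph that consists of the start symbol alone. -/
def startGraph : G.Hypergraph := {Hyperarc.nonterm G.start []}

/-- An infinite sequence of complete parallel rewriting steps from the start symbol. -/
structure Derivation where
  H : ℕ → G.Hypergraph
  h : ℕ → Fin G.numNonterm → List ℕ → ℕ → ℕ
  H_zero : H 0 = G.startGraph
  step : ∀ n, G.Rewrites (H n) (H (n + 1)) (h n)

/-- The graph generated by a derivation: all the terminal arcs and colours that it produces. -/
def Derivation.graph {G : HRGrammar} (D : G.Derivation) : G.Hypergraph :=
  ⋃ n, terminalPart (D.H n)

/-- The vertex of the generated graph that comes from the vertex `x` of the right-hand side of the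
start symbol. -/
def Derivation.rootImage {G : HRGrammar} (D : G.Derivation) (x : ℕ) : ℕ :=
  D.h 0 G.start [] x

/-! Every grammar has a derivation. -/

/-- An auxiliary invariant of derivations. -/
def Good (M : G.Hypergraph) : Prop :=
  (vertexSet M).Finite ∧ ({p : Fin G.numNonterm × List ℕ | Hyperarc.nonterm p.1 p.2 ∈ M}).Finite ∧
    ∀ A w, Hyperarc.nonterm A w ∈ M → w.length = G.rank A ∧ w.Nodup

theorem vertexSet_ruleGraph_finite (A : Fin G.numNonterm) :
    (vertexSet (G.ruleGraph A)).Finite := by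
  have : vertexSet (G.ruleGraph A) = {v | v ∈ (G.rhs A).flatMap Hyperarc.verts} := by
    ext v
    simp [vertexSet, ruleGraph]
  rw [this]
  exact List.finite_toSet _

theorem mem_verts_map {N L C V W : Type} (h : V → W) (e : Hyperarc N L C V) :
    (e.map h).verts = e.verts.map h := by
  cases e <;> simp [Hyperarc.map, Hyperarc.verts]

theorem exists_rewrites (M : G.Hypergraph) (hM : G.Good M) :
    ∃ h M', G.Rewrites M M' h ∧ G.Good M' := by
  classical
  obtain ⟨hfin, hnt, hwf⟩ := hM
  obtain ⟨b, hb⟩ := hfin.bddAbove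
  let h : Fin G.numNonterm → List ℕ → ℕ → ℕ := fun A w x =>
    if x ∈ G.inputs A then w.getD ((G.inputs A).idxOf x) 0
    else b + 1 + Encodable.encode ((A, w), x)
  have hnew : ∀ A w x, x ∉ G.inputs A → h A w x = b + 1 + Encodable.encode ((A, w), x) := by
    intro A w x hx
    simp [h, hx]
  have hget : ∀ A w, Hyperarc.nonterm A w ∈ M → ∀ x (hx : x ∈ G.inputs A),
      ∃ hl : (G.inputs A).idxOf x < w.length, h A w x = w[(G.inputs A).idxOf x] := by
    intro A w hAw x hx
    have hl : (G.inputs A).idxOf x < w.length := by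
      rw [(hwf A w hAw).1, ← G.length_inputs A]
      exact List.idxOf_lt_length_iff.2 hx
    refine ⟨hl, ?_⟩
    simp [h, hx, hl]
  have hle : ∀ A w, Hyperarc.nonterm A w ∈ M → ∀ x ∈ G.inputs A, h A w x ≤ b := by
    intro A w hAw x hx
    obtain ⟨hl, e⟩ := hget A w hAw x hx
    rw [e]
    exact hb ⟨_, hAw, List.getElem_mem hl⟩
  have hinj : ∀ A w, Hyperarc.nonterm A w ∈ M → Function.Injective (h A w) := by
    intro A w hAw x y hxy
    by_cases hx : x ∈ G.inputs A <;> by_cases hy : y ∈ G.inputs A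
    · obtain ⟨hlx, ex⟩ := hget A w hAw x hx
      obtain ⟨hly, ey⟩ := hget A w hAw y hy
      rw [ex, ey] at hxy
      have := (List.Nodup.getElem_inj_iff (hwf A w hAw).2).1 hxy
      exact (List.idxOf_inj hx).1 this
    · have h1 := hle A w hAw x hx
      rw [hxy, hnew A w y hy] at h1
      omega
    · have h1 := hle A w hAw y hy
      rw [← hxy, hnew A w x hx] at h1
      omega
    · rw [hnew A w x hx, hnew A w y hy] at hxy
      have := Encodable.encode_injective (Nat.add_left_cancel hxy)
      exact (Prod.mk.inj this).2
  refine ⟨h, _, ⟨?_, ?_, ?_, ?_, rfl⟩, ?_, ?_, ?_⟩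
  · intro A w hAw
    apply List.ext_getElem
    · rw [List.length_map, G.length_inputs, (hwf A w hAw).1]
    · intro i h1 h2
      rw [List.getElem_map]
      obtain ⟨hl, e⟩ := hget A w hAw _ (List.getElem_mem (by simpa using h1))
      rw [e]
      congr 1
      exact List.Nodup.idxOf_getElem (G.nodup_inputs A) i (by simpa using h1)
  · intro A w hAw
    exact (hinj A w hAw).injOn
  · intro A w _ x hx hmem
    have := hb hmem
    rw [hnew A w x hx.2] at this
    omega
  · intro A w _ B u _ hne x hx y hy hxy
    rw [hnew A w x hx.2, hnew B u y hy.2] at hxy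
    have := Encodable.encode_injective (Nat.add_left_cancel hxy)
    exact hne (Prod.mk.inj this).1
  · have hU : (⋃ p ∈ {p : Fin G.numNonterm × List ℕ | Hyperarc.nonterm p.1 p.2 ∈ M},
        h p.1 p.2 '' vertexSet (G.ruleGraph p.1)).Finite :=
      hnt.biUnion fun p _ => (G.vertexSet_ruleGraph_finite p.1).image _
    refine (hfin.union hU).subset ?_
    rintro v ⟨e, he | ⟨A, w, hAw, r, hr, rfl⟩, hv⟩
    · exact Or.inl ⟨e, he.1, hv⟩
    · rw [mem_verts_map, List.mem_map] at hv
      obtain ⟨x, hx, rfl⟩ := hv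
      right
      simp only [Set.mem_iUnion]
      exact ⟨(A, w), hAw, x, ⟨r, hr, hx⟩, rfl⟩
  · let f : (Fin G.numNonterm × List ℕ) →
        Hyperarc (Fin G.numNonterm) (Fin G.numLabels) (Fin G.numColours) ℕ → Fin G.numNonterm × List ℕ :=
      fun p e => match e.map (h p.1 p.2) with
        | .nonterm B u => (B, u)
        | .arc _ _ _ => p
        | .colour _ _ => p
    have hU : (⋃ p ∈ {p : Fin G.numNonterm × List ℕ | Hyperarc.nonterm p.1 p.2 ∈ M},
        f p '' {e | e ∈ G.rhs p.1}).Finite :=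
      hnt.biUnion fun p _ => (List.finite_toSet _).image _
    refine hU.subset ?_
    rintro ⟨B, u⟩ (he | ⟨A, w, hAw, r, hr, he⟩)
    · exact he.2.elim
    · simp only [Set.mem_iUnion]
      refine ⟨(A, w), hAw, r, hr, ?_⟩
      simp only at he
      simp [f, ← he]
  · rintro B u (he | ⟨A, w, hAw, r, hr, he⟩)
    · exact he.2.elim
    · cases r with
      | arc a s t => simp [Hyperarc.map] at he
      | colour c v => simp [Hyperarc.map] at he
      | nonterm B' u' =>
        simp only [Hyperarc.map, Hyperarc.nonterm.injEq] at he
        obtain ⟨rfl, rfl⟩ := he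
        have := G.rhs_wf A B u' hr
        exact ⟨by rw [List.length_map]; exact this.1, this.2.2.map (hinj A w hAw)⟩

theorem nonempty_derivation : Nonempty G.Derivation := by
  have h0 : G.Good G.startGraph := by
    refine ⟨?_, ?_, ?_⟩
    · have : vertexSet G.startGraph = ∅ := by
        ext v
        simp [vertexSet, startGraph, Hyperarc.verts]
      rw [this]
      exact Set.finite_empty
    · refine (Set.finite_singleton (G.start, ([] : List ℕ))).subset ?_
      rintro ⟨A, w⟩ he
      simpa [startGraph] using he
    · intro A w he
      simp only [startGraph, Set.mem_singleton_iff, Hyperarc.nonterm.injEq] at he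
      obtain ⟨rfl, rfl⟩ := he
      simp [G.rank_start]
  choose h M' hR hG using G.exists_rewrites
  let S : ℕ → {M : G.Hypergraph // G.Good M} := fun n =>
    Nat.rec ⟨G.startGraph, h0⟩ (fun _ M => ⟨M' M.1 M.2, hG M.1 M.2⟩) n
  exact ⟨⟨fun n => (S n).1, fun n => h (S n).1 (S n).2, rfl, fun n => hR (S n).1 (S n).2⟩⟩

/-- A chosen derivation. The generated graph does not depend on it, up to isomorphism. -/
noncomputable def derivation : G.Derivation := Classical.choice G.nonempty_derivation

/-- The graph `R^ω` generated by the grammar. -/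
noncomputable def graph : G.Hypergraph := G.derivation.graph

end HRGrammar

/-! ## Markov chains and PCTL -/

/-- Labelled Markov chains: `step s t` is the probability to move from `s` to `t`, and `label s` is
the set of the atomic propositions that hold in `s`. -/
structure LabelledMarkovChain (S AP : Type) where
  step : S → PMF S
  label : S → Set AP

namespace LabelledMarkovChain

variable {S AP : Type} [MeasurableSpace S] [DiscreteMeasurableSpace S] [Countable S]

/-- The one-step transition kernel. -/
noncomputable def kernel (M : LabelledMarkovChain S AP) : Kernel S S :=
  Kernel.ofFunOfCountable fun s => (M.step s).toMeasure

instance (M : LabelledMarkovChain S AP) : IsMarkovKernel M.kernel :=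
  ⟨fun s => by change IsProbabilityMeasure (M.step s).toMeasure; infer_instance⟩

/-- The law of the infinite paths of the chain that start in `s`. -/
noncomputable def pathMeasure (M : LabelledMarkovChain S AP) (s : S) : Measure (ℕ → S) :=
  Kernel.traj (X := fun _ => S)
    (fun n => M.kernel.comap (fun x : (i : Finset.Iic n) → S => x ⟨n, Finset.mem_Iic.2 le_rfl⟩)
      (measurable_pi_apply _))
    0 (fun _ => s)

end LabelledMarkovChain

/-- Rational numbers in the unit interval. -/
abbrev RatProb : Type := Set.Icc (0 : ℚ) 1

/-- The comparison symbols of PCTL. -/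
inductive Comparison
  | le
  | lt
  | gt
  | ge

/-- The comparison of a real number with a threshold. -/
def Comparison.holds : Comparison → ℝ → ℝ → Prop
  | le, x, r => x ≤ r
  | lt, x, r => x < r
  | gt, x, r => x > r
  | ge, x, r => x ≥ r

/-- PCTL formulae over the atomic propositions `AP`, with rational thresholds. -/
inductive PCTL (AP : Type) : Type
  | tt
  | atom (a : AP)
  | neg (φ : PCTL AP)
  | conj (φ ψ : PCTL AP)
  | next (c : Comparison) (ρ : RatProb) (φ : PCTL AP)
  | untl (c : Comparison) (ρ : RatProb) (φ ψ : PCTL AP)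

/-- Paths whose second state is in `A`. -/
def nextPaths {S : Type} (A : Set S) : Set (ℕ → S) := {ω | ω 1 ∈ A}

/-- Paths that reach `B`, and stay in `A` before. -/
def untilPaths {S : Type} (A B : Set S) : Set (ℕ → S) :=
  {ω | ∃ k, ω k ∈ B ∧ ∀ j < k, ω j ∈ A}

/-- The set of the states in which a PCTL formula holds. -/
def LabelledMarkovChain.sat {S AP : Type} [MeasurableSpace S] [DiscreteMeasurableSpace S]
    [Countable S] (M : LabelledMarkovChain S AP) : PCTL AP → Set S
  | .tt => Set.univ
  | .atom a => {s | a ∈ M.label s}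
  | .neg φ => (M.sat φ)ᶜ
  | .conj φ ψ => M.sat φ ∩ M.sat ψ
  | .next c ρ φ => {s | c.holds ((M.pathMeasure s).real (nextPaths (M.sat φ))) ((ρ : ℚ) : ℝ)}
  | .untl c ρ φ ψ =>
      {s | c.holds ((M.pathMeasure s).real (untilPaths (M.sat φ) (M.sat ψ))) ((ρ : ℚ) : ℝ)}

/-! ## Probabilistic hypergraph grammars -/

/-- The set of the targets of the arcs labelled `a` with source `v`. -/
def targets {N L C V : Type} (M : Set (Hyperarc N L C V)) (v : V) (a : L) : Set V :=
  {t | Hyperarc.arc a v t ∈ M}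

/-- Probabilistic hypergraph grammars: each arc label has a probability, and at each vertex of the
generated graph there are finitely many outgoing arcs, with probabilities that sum up to `1`. -/
structure PHRGrammar extends HRGrammar where
  μ : Fin numLabels → RatProb
  finite_targets : ∀ v ∈ vertexSet toHRGrammar.graph, ∀ a, (targets toHRGrammar.graph v a).Finite
  sum_eq_one : ∀ v ∈ vertexSet toHRGrammar.graph,
    ∑ a, (μ a : ℚ) * ((targets toHRGrammar.graph v a).ncard : ℚ) = 1

namespace PHRGrammar

variable (P : PHRGrammar)

/-- The vertices of the generated graph, which are the states of the Markov chain. -/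
abbrev Vertex : Type := {v : ℕ // v ∈ vertexSet P.graph}

instance : MeasurableSpace P.Vertex := ⊤

instance : DiscreteMeasurableSpace P.Vertex := ⟨fun _ => trivial⟩

open Classical in
/-- The transition probabilities: the sum of the probabilities of the arcs from `s` to `t`. -/
noncomputable def transProb (s t : ℕ) : ℝ≥0∞ :=
  ∑ a, if t ∈ targets P.graph s a then ENNReal.ofReal ((P.μ a : ℚ) : ℝ) else 0

theorem tsum_transProb (s : P.Vertex) : ∑' t : P.Vertex, P.transProb s t = 1 := by
  classical
  have hsub : Function.support (fun t : ℕ => P.transProb s t) ⊆ vertexSet P.graph := by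
    intro t ht
    simp only [transProb, Function.mem_support, ne_eq, Finset.sum_eq_zero_iff, Finset.mem_univ,
      true_implies, not_forall] at ht
    obtain ⟨a, ha⟩ := ht
    have hm : t ∈ targets P.graph s a := by
      by_contra hc
      exact ha (if_neg hc)
    exact ⟨_, hm, by simp [Hyperarc.verts]⟩
  have h1 : ∑' t : P.Vertex, P.transProb s t = ∑' t : ℕ, P.transProb s t :=
    tsum_subtype_eq_of_support_subset (f := fun t : ℕ => P.transProb s t) hsub
  rw [h1]
  unfold transProb
  rw [Summable.tsum_finsetSum (fun _ _ => ENNReal.summable)]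
  have h2 : ∀ a, (∑' t : ℕ, if t ∈ targets P.graph (s : ℕ) a
      then ENNReal.ofReal ((P.μ a : ℚ) : ℝ) else 0) =
      ENNReal.ofReal (((P.μ a : ℚ) * ((targets P.graph (s : ℕ) a).ncard : ℚ) : ℚ) : ℝ) := by
    intro a
    have hf := P.finite_targets s s.2 a
    rw [tsum_eq_sum (s := hf.toFinset) (by intro t ht; rw [if_neg (by simpa using ht)]),
      Finset.sum_congr rfl (g := fun _ => ENNReal.ofReal ((P.μ a : ℚ) : ℝ))
        (by intro t ht; rw [if_pos (by simpa using ht)]),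
      Finset.sum_const, ← Set.ncard_eq_toFinset_card _ hf, nsmul_eq_mul]
    push_cast
    rw [ENNReal.ofReal_mul (by exact_mod_cast (P.μ a).2.1), ENNReal.ofReal_natCast, mul_comm]
  rw [Finset.sum_congr rfl (fun a _ => h2 a), ← ENNReal.ofReal_sum_of_nonneg, ← Rat.cast_sum,
    P.sum_eq_one s s.2]
  · simp
  · intro a _
    have := (P.μ a).2.1
    exact_mod_cast mul_nonneg this (Nat.cast_nonneg _)

/-- The labelled Markov chain induced by a probabilistic hypergraph grammar. Its atomic propositions
are the colours of the grammar. -/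
noncomputable def chain : LabelledMarkovChain P.Vertex (Fin P.numColours) where
  step s := ⟨fun t => P.transProb s t, (P.tsum_transProb s) ▸ ENNReal.summable.hasSum⟩
  label s := {c | Hyperarc.colour c (s : ℕ) ∈ P.graph}

end PHRGrammar

/-! ## The model-checking problem and its instances -/

/-- An instance: a probabilistic hypergraph grammar and a PCTL formula over its colours. -/
structure Instance where
  P : PHRGrammar
  φ : PCTL (Fin P.numColours)

/-- The formula holds at all vertices of the generated Markov chain. -/
def Instance.Valid (I : Instance) : Prop := ∀ v : I.P.Vertex, v ∈ I.P.chain.sat I.φ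

/-- The formula holds at some vertex of the generated Markov chain. -/
def Instance.Satisfiable (I : Instance) : Prop := ∃ v : I.P.Vertex, v ∈ I.P.chain.sat I.φ

/-- An instance together with an initial vertex `x` in the right-hand side of the start symbol; its
image in the generated graph is required to be a state of the Markov chain. -/
structure RootedInstance extends Instance where
  x : ℕ
  x_mem : x ∈ vertexSet (P.ruleGraph P.start)
  root_mem : P.derivation.rootImage x ∈ vertexSet P.graph

/-- The formula holds at the initial vertex. -/
def RootedInstance.Holds (I : RootedInstance) : Prop :=
  (⟨I.P.derivation.rootImage I.x, I.root_mem⟩ : I.P.Vertex) ∈ I.P.chain.sat I.φ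

/-! ## Encodings of the instances, and decidability -/

/-- A rational number in the unit interval is encoded by its numerator and denominator. -/
def RatProb.code (q : RatProb) : ℕ × ℕ := ((q : ℚ).num.toNat, (q : ℚ).den)

/-- A hyperarc is encoded by its kind and the list of its symbol and its vertices. -/
def Hyperarc.code {n l c : ℕ} : Hyperarc (Fin n) (Fin l) (Fin c) ℕ → ℕ × List ℕ
  | nonterm A w => (0, A.val :: w)
  | arc a s t => (1, [a.val, s, t])
  | colour d v => (2, [d.val, v])

/-- A number for each comparison symbol. -/
def Comparison.code : Comparison → ℕ
  | le => 0
  | lt => 1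
  | gt => 2
  | ge => 3

/-- The Gödel number of a PCTL formula. -/
def PCTL.code {k : ℕ} : PCTL (Fin k) → ℕ
  | tt => Nat.pair 0 0
  | atom a => Nat.pair 1 a.val
  | neg φ => Nat.pair 2 φ.code
  | conj φ ψ => Nat.pair 3 (Nat.pair φ.code ψ.code)
  | next c ρ φ => Nat.pair 4 (Nat.pair c.code (Nat.pair (Nat.pair ρ.code.1 ρ.code.2) φ.code))
  | .untl c ρ φ ψ => Nat.pair 5 (Nat.pair c.code
      (Nat.pair (Nat.pair ρ.code.1 ρ.code.2) (Nat.pair φ.code ψ.code)))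

/-- The type of the codes of grammars: the start symbol, the number of colours, the list of the
probabilities of the labels, and, for each non-terminal, its arity, its inputs and its hyperarcs. -/
abbrev GrammarCode : Type := ℕ × ℕ × List (ℕ × ℕ) × List (ℕ × List ℕ × List (ℕ × List ℕ))

/-- The code of a probabilistic hypergraph grammar. -/
def PHRGrammar.code (P : PHRGrammar) : GrammarCode :=
  (P.start.val, P.numColours, List.ofFn fun a => RatProb.code (P.μ a),
    List.ofFn fun A => (P.rank A, P.inputs A, (P.rhs A).map Hyperarc.code))

/-- The code of an instance. -/
def Instance.code (I : Instance) : GrammarCode × ℕ := (I.P.code, I.φ.code)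

/-- The code of an instance with an initial vertex. -/
def RootedInstance.code (I : RootedInstance) : (GrammarCode × ℕ) × ℕ := (I.toInstance.code, I.x)

theorem RatProb.code_injective : Function.Injective RatProb.code := by
  rintro ⟨p, hp⟩ ⟨q, hq⟩ h
  simp only [RatProb.code, Prod.mk.injEq] at h
  have h1 := Rat.num_nonneg.2 hp.1
  have h2 := Rat.num_nonneg.2 hq.1
  exact Subtype.ext (Rat.ext (by change p.num = q.num; omega) h.2)

theorem Hyperarc.code_injective {n l c : ℕ} :
    Function.Injective (Hyperarc.code (n := n) (l := l) (c := c)) := by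
  rintro (⟨A, w⟩ | ⟨a, s, t⟩ | ⟨d, v⟩) (⟨A', w'⟩ | ⟨a', s', t'⟩ | ⟨d', v'⟩) h <;>
    simp_all [Hyperarc.code, Fin.ext_iff]

theorem Comparison.code_injective : Function.Injective Comparison.code := by
  intro c d h
  cases c <;> cases d <;> simp_all [Comparison.code]

theorem PCTL.code_injective {k : ℕ} : Function.Injective (PCTL.code (k := k)) := by
  intro φ
  have hρ : ∀ ρ ρ' : RatProb, ρ.code.1 = ρ'.code.1 → ρ.code.2 = ρ'.code.2 → ρ = ρ' :=
    fun ρ ρ' h1 h2 => RatProb.code_injective (Prod.ext h1 h2)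
  induction φ with
  | tt => intro ψ h; cases ψ <;> simp_all [PCTL.code, Nat.pair_eq_pair]
  | atom a => intro ψ h; cases ψ <;> simp_all [PCTL.code, Nat.pair_eq_pair, Fin.ext_iff]
  | neg φ ih =>
    intro ψ h
    cases ψ <;> simp [PCTL.code, Nat.pair_eq_pair] at h
    rw [ih h]
  | conj φ φ' ih ih' =>
    intro ψ h
    cases ψ <;> simp [PCTL.code, Nat.pair_eq_pair] at h
    rw [ih h.1, ih' h.2]
  | next c ρ φ ih =>
    intro ψ h
    cases ψ <;> simp only [PCTL.code, Nat.pair_eq_pair] at h <;> try omega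
    obtain ⟨-, hc, hr, hφ⟩ := h
    rw [Comparison.code_injective hc, hρ _ _ hr.1 hr.2, ih hφ]
  | untl c ρ φ φ' ih ih' =>
    intro ψ h
    cases ψ <;> simp only [PCTL.code, Nat.pair_eq_pair] at h <;> try omega
    obtain ⟨-, hc, hr, hφ, hφ'⟩ := h
    rw [Comparison.code_injective hc, hρ _ _ hr.1 hr.2, ih hφ, ih' hφ']

theorem PHRGrammar.code_injective : Function.Injective PHRGrammar.code := by
  rintro ⟨⟨n, l, c, rk, s, _, r, i, _, _, _, _⟩, μ, _, _⟩
    ⟨⟨n', l', c', rk', s', _, r', i', _, _, _, _⟩, μ', _, _⟩ h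
  simp only [PHRGrammar.code, Prod.mk.injEq] at h
  obtain ⟨hs, rfl, hμ, hr⟩ := h
  have hl : l = l' := by simpa using congrArg List.length hμ
  have hn : n = n' := by simpa using congrArg List.length hr
  subst hl hn
  obtain rfl : s = s' := Fin.ext hs
  have hμ' := List.ofFn_injective hμ
  have hr' := List.ofFn_injective hr
  obtain rfl : μ = μ' := funext fun a => RatProb.code_injective (congrFun hμ' a)
  have e : ∀ A, rk A = rk' A ∧ i A = i' A ∧
      (r A).map Hyperarc.code = (r' A).map Hyperarc.code := by
    intro A
    simpa using congrFun hr' A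
  obtain rfl : rk = rk' := funext fun A => (e A).1
  obtain rfl : i = i' := funext fun A => (e A).2.1
  obtain rfl : r = r' :=
    funext fun A => (List.map_injective_iff.2 Hyperarc.code_injective) (e A).2.2
  rfl

theorem Instance.code_injective : Function.Injective Instance.code := by
  rintro ⟨P, φ⟩ ⟨P', φ'⟩ h
  simp only [Instance.code, Prod.mk.injEq] at h
  obtain ⟨hP, hφ⟩ := h
  obtain rfl := PHRGrammar.code_injective hP
  rw [PCTL.code_injective hφ]

theorem RootedInstance.code_injective : Function.Injective RootedInstance.code := by
  rintro ⟨I, x, _, _⟩ ⟨I', x', _, _⟩ h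
  simp only [RootedInstance.code, Prod.mk.injEq] at h
  obtain ⟨hI, rfl⟩ := h
  obtain rfl := Instance.code_injective hI
  rfl

/-- A decision problem, given by its instances, their codes, and a question `Q`, is decidable if
some algorithm (a partial recursive function) halts on the code of each instance and gives the right
answer. Nothing is required of the algorithm on inputs that are not codes of instances. -/
def DecidableProblem {I α : Type} [Primcodable α] (code : I → α) (Q : I → Prop) : Prop :=
  ∃ f : α →. Bool, Partrec f ∧ ∀ x : I, ∃ b, b ∈ f (code x) ∧ (b = true ↔ Q x)

end ProbHypergraph

/-! The halting problem is reduced to model checking over one fixed grammar; only the formula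
depends on the input `n`.

Exact probabilities can compare numbers of letters. The main nodes of the generated graph form the
tree of all words over a finite alphabet of counter instructions. The test node of a word `w`
enters, with probability 1/2 each, an upper or a lower branch; both lead down to the empty word, and
at each letter make a detour through a mark of that letter with probability 1/2. If upper marks of
letters in `I` are forbidden and the upper end is a goal, the upper branch succeeds with probability
`2^(-p)`, where `p` counts the letters of `w` in `I`. If lower marks of letters in `J` are goals and
the lower end is forbidden, the lower branch succeeds with probability `1 - 2^(-q)`, where `q`
counts the letters in `J`. The until probability at the test node is therefore `(2^(-p) + 1 -
2^(-q)) / 2` (`compareProb_test`). It equals 1/2 iff `p = q` (`sat_compareF_half`); for empty `J` it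
equals `2^(-(n+1))` iff `p = n` (`sat_compareF_nil`). Counters are differences of letter counts, so
the first fact expresses tests for equality and for zero, and the second compares the final content
of a counter that is never decremented with the input.

An until formula with threshold `> 0` says that some path from the root stays in main nodes whose
last instruction has passed its test and ends in an accepting node. Such a path spells an execution
of the program (`canReach_iff`).

The programs are regular expressions over instructions. They need not compute: they guess values and
verify them, which suffices for every primitive recursive function (`exists_checks`), hence for the
relation "halts within `t` steps" (`exists_program`). An automaton for the regular expression
supplies the control (`exists_dfa`), and its states are the non-terminals of the grammar.

Two links complete the proof: first-step equations for the path measure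
(`pathMeasure_untilPaths_step`, `pathMeasure_untilPaths_ne_zero_iff`), and the identification of the
graph of an arbitrary derivation with an explicit graph of nodes (`arc_mem_graph`,
`colour_mem_graph`, `vertexSet_graph`). -/

namespace ProbHypergraph

/-! ### The path measure: cylinders, first-step equations, positivity of until probabilities. -/

namespace LabelledMarkovChain

/-- The paths that agree with `x` up to time `n`. -/
def pathCylinder {S : Type} (n : ℕ) (x : ℕ → S) : Set (ℕ → S) := {ω | ∀ i ≤ n, ω i = x i}

/-- The path that starts in `s` and goes on with `ω`. -/
def consPath {S : Type} (s : S) (ω : ℕ → S) : ℕ → S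
  | 0 => s
  | n + 1 => ω n

variable {S AP : Type} [MeasurableSpace S] [DiscreteMeasurableSpace S] [Countable S]

theorem measurableSet_pathCylinder (n : ℕ) (x : ℕ → S) : MeasurableSet (pathCylinder n x) := by
  have : pathCylinder n x = ⋂ i ≤ n, (fun ω : ℕ → S => ω i) ⁻¹' {x i} := by
    ext ω; simp [pathCylinder]
  rw [this]
  exact MeasurableSet.biInter (Set.to_countable _) fun i _ =>
    measurable_pi_apply i (MeasurableSet.of_discrete)

theorem measurable_consPath (s : S) : Measurable (consPath s) := by
  refine measurable_pi_iff.2 fun n => ?_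
  cases n with
  | zero => exact measurable_const
  | succ n => exact measurable_pi_apply n

/-- Two cylinders that meet are nested, so the cylinders form a π-system. They generate the product
σ-algebra because `S` is countable: an event that depends on one coordinate is a countable union of
cylinders. -/
theorem ext_of_pathCylinder {μ ν : Measure (ℕ → S)} [IsProbabilityMeasure μ]
    [IsProbabilityMeasure ν] (h : ∀ n x, μ (pathCylinder n x) = ν (pathCylinder n x)) : μ = ν := by
  refine ext_of_generate_finite {A | ∃ n x, A = pathCylinder n x} (le_antisymm ?_ ?_) ?_ ?_ (by simp)
  · refine iSup_le fun n => ?_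
    rintro A ⟨B, -, rfl⟩
    -- The value `y 0` only pads the finite prefix to an infinite path; the cylinder never reads it.
    have : (fun ω : ℕ → S => ω n) ⁻¹' B =
        ⋃ y ∈ {y : Fin (n + 1) → S | y (Fin.last n) ∈ B},
          pathCylinder n fun i => if h : i < n + 1 then y ⟨i, h⟩ else y 0 := by
      ext ω
      simp only [Set.mem_preimage, Set.mem_ofPred_eq, Set.mem_iUnion, pathCylinder, exists_prop]
      constructor
      · intro hω
        refine ⟨fun i => ω i, hω, fun i hi => ?_⟩
        rw [dif_pos (Nat.lt_succ_of_le hi)]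
      · rintro ⟨y, hy, hω⟩
        rw [hω n le_rfl, dif_pos (Nat.lt_succ_self n)]
        exact hy
    rw [this]
    exact MeasurableSet.biUnion (Set.to_countable _) fun y _ =>
      MeasurableSpace.measurableSet_generateFrom ⟨_, _, rfl⟩
  · refine MeasurableSpace.generateFrom_le ?_
    rintro A ⟨n, x, rfl⟩
    exact measurableSet_pathCylinder n x
  · have key : ∀ n m (x y : ℕ → S), n ≤ m → (pathCylinder n x ∩ pathCylinder m y).Nonempty →
        pathCylinder n x ∩ pathCylinder m y = pathCylinder m y := by
      rintro n m x y hnm ⟨ω, h1, h2⟩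
      refine Set.inter_eq_right.2 fun ω' h' i hi => ?_
      rw [h' i (hi.trans hnm), ← h2 i (hi.trans hnm), h1 i hi]
    rintro _ ⟨n, x, rfl⟩ _ ⟨m, y, rfl⟩ hne
    rcases le_total n m with hnm | hnm
    · exact ⟨m, y, key n m x y hnm hne⟩
    · rw [Set.inter_comm] at hne ⊢
      exact ⟨n, x, key m n y x hnm hne⟩
  · rintro _ ⟨n, x, rfl⟩
    exact h n x

variable (M : LabelledMarkovChain S AP)

instance (s : S) : IsProbabilityMeasure (M.pathMeasure s) := by
  unfold pathMeasure; infer_instance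

theorem pathMeasure_pathCylinder_zero (s : S) (x : ℕ → S) :
    M.pathMeasure s (pathCylinder 0 x) = Set.indicator {s} 1 (x 0) := by
  classical
  unfold pathMeasure
  have h := Kernel.traj_map_frestrictLe_apply (X := fun _ => S)
    (κ := fun n => M.kernel.comap (fun x : (i : Finset.Iic n) → S => x ⟨n, Finset.mem_Iic.2 le_rfl⟩)
      (measurable_pi_apply _)) 0 0 (fun _ => s)
  have hc : pathCylinder 0 x = Preorder.frestrictLe 0 ⁻¹'
      {y : (i : Finset.Iic 0) → S | y ⟨0, by simp⟩ = x 0} := by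
    ext ω; simp [pathCylinder]
  have hm : MeasurableSet {y : (i : Finset.Iic 0) → S | y ⟨0, by simp⟩ = x 0} :=
    MeasurableSet.of_discrete
  rw [hc, ← Measure.map_apply (by fun_prop) hm, h, Kernel.partialTraj_self, Kernel.id_apply,
    Measure.dirac_apply' _ hm]
  simp [Set.indicator, eq_comm]

/-- Disintegration at time `n`: a trajectory continued from a known prefix keeps that prefix almost
surely, and its next state is distributed according to the transition kernel at the last state of
the prefix. -/
theorem pathMeasure_pathCylinder_succ (s : S) (n : ℕ) (x : ℕ → S) :
    M.pathMeasure s (pathCylinder (n + 1) x) =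
      M.pathMeasure s (pathCylinder n x) * M.step (x n) (x (n + 1)) := by
  classical
  unfold pathMeasure
  set κ : (n : ℕ) → Kernel ((i : Finset.Iic n) → S) S := fun n =>
    M.kernel.comap (fun x : (i : Finset.Iic n) → S => x ⟨n, Finset.mem_Iic.2 le_rfl⟩)
      (measurable_pi_apply _) with hκ
  set z : (i : Finset.Iic n) → S := fun i => x i
  have hcyl : pathCylinder n x = Preorder.frestrictLe n ⁻¹' ({z} : Set ((i : Finset.Iic n) → S)) := by
    ext ω
    simp [pathCylinder, z, funext_iff, Preorder.frestrictLe]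
  have hdirac : ∀ y, Kernel.traj (X := fun _ => S) κ n y (pathCylinder n x) =
      Set.indicator {z} 1 y := by
    intro y
    rw [hcyl, ← Measure.map_apply (by fun_prop) MeasurableSet.of_discrete,
      Kernel.traj_map_frestrictLe_apply, Kernel.partialTraj_self, Kernel.id_apply,
      Measure.dirac_apply' _ MeasurableSet.of_discrete]
  have hstep : ∀ y, Kernel.traj (X := fun _ => S) κ n y (pathCylinder (n + 1) x) =
      Set.indicator {z} (fun _ => M.step (x n) (x (n + 1))) y := by
    intro y
    by_cases hy : y = z
    · subst hy
      rw [Set.indicator_of_mem (Set.mem_singleton _)]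
      have hone : Kernel.traj (X := fun _ => S) κ n z (pathCylinder n x) = 1 := by
        rw [hdirac]; simp
      have hs : pathCylinder (n + 1) x = pathCylinder n x ∩
          (fun ω : ℕ → S => ω (n + 1)) ⁻¹' {x (n + 1)} := by
        ext ω
        simp only [pathCylinder, Set.mem_ofPred_eq, Set.mem_inter_iff, Set.mem_preimage,
          Set.mem_singleton_iff]
        refine ⟨fun h => ⟨fun i hi => h i (by omega), h _ le_rfl⟩, fun h i hi => ?_⟩
        rcases Nat.lt_or_ge n i with hi' | hi'
        · obtain rfl : i = n + 1 := by omega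
          exact h.2
        · exact h.1 i hi'
      have hae : (Kernel.traj (X := fun _ => S) κ n z) (pathCylinder n x)ᶜ = 0 :=
        (prob_compl_eq_zero_iff (measurableSet_pathCylinder n x)).2 hone
      rw [hs, Measure.measure_inter_eq_of_ae (s := (fun ω : ℕ → S => ω (n + 1)) ⁻¹' {x (n + 1)})
        (t := pathCylinder n x) hae]
      have hmap := DFunLike.congr_fun
        (Kernel.map_traj_succ_self (X := fun _ => S) (κ := κ) (a := n)) z
      rw [Kernel.map_apply _ (measurable_pi_apply _)] at hmap
      rw [← Measure.map_apply (measurable_pi_apply _) MeasurableSet.of_discrete, hmap]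
      change (M.step (x n)).toMeasure {x (n + 1)} = _
      exact PMF.toMeasure_apply_singleton _ _ MeasurableSet.of_discrete
    · rw [Set.indicator_of_notMem (by simpa using hy)]
      refine measure_mono_null (t := pathCylinder n x) (fun ω h i hi => h i (by omega)) ?_
      rw [hdirac]; simp [hy]
  have hcomp := Kernel.traj_comp_partialTraj (X := fun _ => S) (κ := κ) (Nat.zero_le n)
  have h1 : ∀ A, MeasurableSet A → Kernel.traj (X := fun _ => S) κ 0 (fun _ => s) A =
      ∫⁻ y, Kernel.traj (X := fun _ => S) κ n y A
        ∂(Kernel.partialTraj (X := fun _ => S) κ 0 n (fun _ => s)) := by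
    intro A hA
    rw [← hcomp, Kernel.comp_apply' _ _ _ hA]
  rw [h1 _ (measurableSet_pathCylinder _ _), h1 _ (measurableSet_pathCylinder _ _)]
  simp_rw [hstep, hdirac]
  rw [lintegral_indicator MeasurableSet.of_discrete, lintegral_indicator MeasurableSet.of_discrete]
  simp [mul_comm]

/-- Moves the recursion from the last step of the cylinder to the first one, as needed for
conditioning on the first transition. -/
theorem pathMeasure_pathCylinder_consPath (s : S) (n : ℕ) (x : ℕ → S) :
    M.pathMeasure s (pathCylinder (n + 1) x) =
      Set.indicator {s} 1 (x 0) *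
        (M.step s (x 1) * M.pathMeasure (x 1) (pathCylinder n fun i => x (i + 1))) := by
  classical
  induction n with
  | zero =>
    rw [pathMeasure_pathCylinder_succ, pathMeasure_pathCylinder_zero, pathMeasure_pathCylinder_zero]
    by_cases h : x 0 = s <;> simp [h]
  | succ n ih =>
    rw [pathMeasure_pathCylinder_succ, ih, pathMeasure_pathCylinder_succ]
    ring

/-- First-step decomposition: both sides are probability measures and agree on cylinders. -/
theorem pathMeasure_eq_sum (s : S) : M.pathMeasure s =
    Measure.sum fun t => M.step s t • (M.pathMeasure t).map (consPath s) := by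
  classical
  have hν : IsProbabilityMeasure
      (Measure.sum fun t => M.step s t • (M.pathMeasure t).map (consPath s)) := by
    constructor
    rw [Measure.sum_apply _ MeasurableSet.univ]
    have : ∀ t, (M.step s t • (M.pathMeasure t).map (consPath s)) Set.univ = M.step s t := by
      intro t
      rw [Measure.smul_apply, Measure.map_apply (measurable_consPath s) MeasurableSet.univ]
      simp
    simp_rw [this]
    exact (M.step s).tsum_coe
  refine ext_of_pathCylinder fun n x => ?_
  rw [Measure.sum_apply _ (measurableSet_pathCylinder n x)]
  simp_rw [Measure.smul_apply, Measure.map_apply (measurable_consPath s)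
    (measurableSet_pathCylinder n x), smul_eq_mul]
  cases n with
  | zero =>
    have : consPath s ⁻¹' pathCylinder 0 x = if x 0 = s then Set.univ else ∅ := by
      ext ω
      split_ifs with h <;> simp [pathCylinder, consPath, h, eq_comm (a := s)]
    rw [this, pathMeasure_pathCylinder_zero]
    split_ifs with h <;> simp [h, (M.step s).tsum_coe]
  | succ n =>
    rw [pathMeasure_pathCylinder_consPath]
    have hp : consPath s ⁻¹' pathCylinder (n + 1) x =
        if x 0 = s then pathCylinder n (fun i => x (i + 1)) else ∅ := by
      ext ω
      have : ω ∈ consPath s ⁻¹' pathCylinder (n + 1) x ↔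
          x 0 = s ∧ ∀ i ≤ n, ω i = x (i + 1) := by
        constructor
        · intro h
          exact ⟨(h 0 (by omega)).symm, fun i hi => h (i + 1) (by omega)⟩
        · rintro ⟨h0, h⟩ i hi
          cases i with
          | zero => exact h0.symm
          | succ i => exact h i (by omega)
      rw [this]
      split_ifs with h <;> simp [pathCylinder, h]
    rw [hp]
    split_ifs with h
    · rw [tsum_eq_single (x 1)]
      · simp [h]
      -- Paths from `t` almost surely start in `t`, so only the term of `x 1` survives.
      · intro t ht
        have := M.pathMeasure_pathCylinder_zero t fun i => x (i + 1)
        rw [Set.indicator_of_notMem (by simpa using ht.symm)] at this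
        rw [measure_mono_null (s := pathCylinder n _) (t := pathCylinder 0 _) (fun ω h i hi => h i (by omega)) this, mul_zero]
    · simp [h]

theorem pathMeasure_apply (s : S) {A : Set (ℕ → S)} (hA : MeasurableSet A) :
    M.pathMeasure s A = ∑' t, M.step s t * M.pathMeasure t (consPath s ⁻¹' A) := by
  conv_lhs => rw [pathMeasure_eq_sum]
  rw [Measure.sum_apply _ hA]
  refine tsum_congr fun t => ?_
  rw [Measure.smul_apply, Measure.map_apply (measurable_consPath s) hA, smul_eq_mul]

theorem pathMeasure_start (s : S) : ∀ᵐ ω ∂M.pathMeasure s, ω 0 = s := by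
  have h := M.pathMeasure_pathCylinder_zero s fun _ => s
  rw [Set.indicator_of_mem (Set.mem_singleton _), Pi.one_apply] at h
  have := (prob_compl_eq_zero_iff (measurableSet_pathCylinder 0 fun _ => s)).2 h
  refine measure_mono_null (fun ω hω => ?_) this
  simpa [pathCylinder] using hω

theorem pathMeasure_nextPaths (s : S) (A : Set S) :
    M.pathMeasure s (nextPaths A) = ∑' t, M.step s t * Set.indicator A 1 t := by
  classical
  rw [M.pathMeasure_apply s (A := nextPaths A)
    (measurable_pi_apply 1 (MeasurableSet.of_discrete (s := A)))]
  refine tsum_congr fun t => ?_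
  congr 1
  have : consPath s ⁻¹' nextPaths A = {ω | ω 0 ∈ A} := rfl
  rw [this]
  by_cases h : t ∈ A
  · rw [Set.indicator_of_mem h, Pi.one_apply]
    exact (prob_compl_eq_zero_iff (measurable_pi_apply 0 (MeasurableSet.of_discrete (s := A)))).1
      (by
        filter_upwards [M.pathMeasure_start t] with ω hω
        simpa [hω] using h)
  · rw [Set.indicator_of_notMem h]
    refine (measure_eq_zero_iff_ae_notMem).2 ?_
    filter_upwards [M.pathMeasure_start t] with ω h0 hω
    exact h (h0 ▸ hω)

/-- Paths that reach `B` before time `n`, and stay in `A` before. -/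
def untilBefore {S : Type} (A B : Set S) (n : ℕ) : Set (ℕ → S) :=
  {ω | ∃ k < n, ω k ∈ B ∧ ∀ j < k, ω j ∈ A}

theorem untilPaths_eq_iUnion (A B : Set S) : untilPaths A B = ⋃ n, untilBefore A B n := by
  ext ω
  simp only [untilPaths, untilBefore, Set.mem_ofPred_eq, Set.mem_iUnion]
  exact ⟨fun ⟨k, h⟩ => ⟨k + 1, k, by omega, h⟩, fun ⟨n, k, _, h⟩ => ⟨k, h⟩⟩

theorem measurableSet_untilBefore (A B : Set S) (n : ℕ) : MeasurableSet (untilBefore A B n) := by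
  have : untilBefore A B n = ⋃ k ∈ Set.Iio n, ((fun ω : ℕ → S => ω k) ⁻¹' B ∩
      ⋂ j ∈ Set.Iio k, (fun ω : ℕ → S => ω j) ⁻¹' A) := by
    ext ω
    simp only [untilBefore, Set.mem_iUnion, Set.mem_inter_iff, Set.mem_iInter, exists_prop]
    rfl
  rw [this]
  exact MeasurableSet.biUnion (Set.to_countable _) fun k _ =>
    (measurable_pi_apply k MeasurableSet.of_discrete).inter
      (MeasurableSet.biInter (Set.to_countable _) fun j _ =>
        measurable_pi_apply j MeasurableSet.of_discrete)

theorem measurableSet_untilPaths (A B : Set S) : MeasurableSet (untilPaths A B) := by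
  rw [untilPaths_eq_iUnion]
  exact MeasurableSet.iUnion (measurableSet_untilBefore A B)

theorem pathMeasure_untilPaths_of_mem {A B : Set S} {s : S} (h : s ∈ B) :
    M.pathMeasure s (untilPaths A B) = 1 := by
  refine (prob_compl_eq_zero_iff (measurableSet_untilPaths A B)).1 ?_
  change ∀ᵐ ω ∂M.pathMeasure s, ω ∈ untilPaths A B
  filter_upwards [M.pathMeasure_start s] with ω hω
  exact ⟨0, by rwa [hω], by simp⟩

theorem pathMeasure_untilPaths_of_notMem {A B : Set S} {s : S} (hA : s ∉ A) (hB : s ∉ B) :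
    M.pathMeasure s (untilPaths A B) = 0 := by
  refine (measure_eq_zero_iff_ae_notMem).2 ?_
  filter_upwards [M.pathMeasure_start s] with ω h0 hω
  obtain ⟨k, hk, hj⟩ := hω
  cases k with
  | zero => exact hB (h0 ▸ hk)
  | succ k => exact hA (h0 ▸ hj 0 (by omega))

/-- Prefixing `s` shifts the time of arrival by one: since `s ∉ B` this time is not zero, and since
`s ∈ A` the prefix violates nothing. -/
theorem pathMeasure_untilPaths_step {A B : Set S} {s : S} (hA : s ∈ A) (hB : s ∉ B) :
    M.pathMeasure s (untilPaths A B) =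
      ∑' t, M.step s t * M.pathMeasure t (untilPaths A B) := by
  rw [M.pathMeasure_apply s (measurableSet_untilPaths A B)]
  refine tsum_congr fun t => ?_
  congr 2
  ext ω
  constructor
  · rintro ⟨k, hk, hj⟩
    cases k with
    | zero => exact absurd hk hB
    | succ k => exact ⟨k, hk, fun j hjk => hj (j + 1) (by omega)⟩
  · rintro ⟨k, hk, hj⟩
    refine ⟨k + 1, hk, fun j hjk => ?_⟩
    cases j with
    | zero => exact hA
    | succ j => exact hj j (by omega)

theorem pathMeasure_untilBefore_succ {A B : Set S} {s : S} (hB : s ∉ B) (n : ℕ) :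
    M.pathMeasure s (untilBefore A B (n + 1)) ≤
      ∑' t, M.step s t * M.pathMeasure t (untilBefore A B n) := by
  rw [M.pathMeasure_apply s (measurableSet_untilBefore A B _)]
  refine ENNReal.tsum_le_tsum fun t => mul_le_mul_right (measure_mono ?_) _
  rintro ω ⟨k, hkn, hk, hj⟩
  cases k with
  | zero => exact absurd hk hB
  | succ k => exact ⟨k, by omega, hk, fun j hjk => hj (j + 1) (by omega)⟩

/-- From some state one can reach `B` through `A` by steps of positive probability. -/
inductive CanReach (A B : Set S) : S → Prop
  | base {s} (h : s ∈ B) : CanReach A B s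
  | step {s t} (h : s ∈ A) (hst : M.step s t ≠ 0) (ht : CanReach A B t) : CanReach A B s

/-- From a state that cannot reach `B`, all transitions of positive probability lead to such states
as long as the path is in `A`, so each time-bounded event is null, by induction on the bound; a
countable union of null events is null. Conversely, one nonzero term in the first-step equation
suffices. -/
theorem pathMeasure_untilPaths_ne_zero_iff {A B : Set S} {s : S} :
    M.pathMeasure s (untilPaths A B) ≠ 0 ↔ M.CanReach A B s := by
  constructor
  · intro h
    by_contra hs
    apply h
    clear h
    rw [untilPaths_eq_iUnion, measure_iUnion_null_iff]
    intro n
    induction n generalizing s with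
    | zero => simp [untilBefore]
    | succ n ih =>
      by_cases hA : s ∈ A
      · have hB : s ∉ B := fun hB => hs (.base hB)
        refine le_antisymm ((M.pathMeasure_untilBefore_succ hB n).trans ?_) (zero_le)
        refine le_of_eq (ENNReal.tsum_eq_zero.2 fun t => ?_)
        by_cases hst : M.step s t = 0
        · rw [hst, zero_mul]
        · rw [ih fun ht => hs (.step hA hst ht), mul_zero]
      · have hB : s ∉ B := fun hB => hs (.base hB)
        refine measure_mono_null ?_ (M.pathMeasure_untilPaths_of_notMem hA hB)
        rintro ω ⟨k, -, h⟩
        exact ⟨k, h⟩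
  · intro h
    induction h with
    | base h => rw [M.pathMeasure_untilPaths_of_mem h]; exact one_ne_zero
    | @step s t h hst _ ih =>
      by_cases hB : s ∈ B
      · rw [M.pathMeasure_untilPaths_of_mem hB]; exact one_ne_zero
      · rw [M.pathMeasure_untilPaths_step h hB]
        intro h0
        rcases mul_eq_zero.1 (ENNReal.tsum_eq_zero.1 h0 t) with h1 | h1
        · exact hst h1
        · exact ih h1

end LabelledMarkovChain

/-! ## Counter programs -/

/-- The contents of the counters. -/
abbrev Counters : Type := ℕ → ℤ

/-- Counter instructions. The counter `0` is never decremented: `dec r` acts on the counter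
`r + 1`. -/
inductive Op : Type
  | inc (r : ℕ)
  | dec (r : ℕ)
  | eq (i j : ℕ)
  | zero (r : ℕ)

namespace Op

/-- The effect of an instruction. -/
def act : Op → Counters → Counters
  | inc r, s => Function.update s r (s r + 1)
  | dec r, s => Function.update s (r + 1) (s (r + 1) - 1)
  | eq _ _, s => s
  | zero _, s => s

/-- The test made by an instruction. -/
def Enabled : Op → Counters → Prop
  | inc _, _ => True
  | dec _, _ => True
  | eq i j, s => s i = s j
  | zero r, s => s r = 0

/-- A sequence of instructions leads from some contents of the counters to others. -/
def Exec : List Op → Counters → Counters → Prop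
  | [], s, s' => s' = s
  | a :: w, s, s' => a.Enabled s ∧ Exec w (a.act s) s'

theorem exec_append {u v : List Op} {s s' : Counters} :
    Exec (u ++ v) s s' ↔ ∃ t, Exec u s t ∧ Exec v t s' := by
  induction u generalizing s with
  | nil => simp [Exec]
  | cons a u ih => simp [Exec, ih, and_assoc]

end Op

/-- Counter programs are regular expressions over instructions. -/
abbrev Program : Type := RegularExpression Op

namespace Program

open RegularExpression

/-- A program can lead from some contents of the counters to others. -/
def Rel (e : Program) (s s' : Counters) : Prop := ∃ w ∈ e.matches', Op.Exec w s s'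

theorem rel_char {a : Op} {s s' : Counters} :
    Rel (char a) s s' ↔ a.Enabled s ∧ s' = a.act s := by
  constructor
  · rintro ⟨w, hw, h⟩
    obtain rfl : w = [a] := hw
    simpa [Op.Exec] using h
  · intro h
    exact ⟨[a], rfl, by simpa [Op.Exec] using h⟩

theorem rel_one {s s' : Counters} : Rel 1 s s' ↔ s' = s := by
  constructor
  · rintro ⟨w, hw, h⟩
    obtain rfl : w = [] := hw
    exact h
  · intro h
    exact ⟨[], rfl, h⟩

theorem rel_add {e f : Program} {s s' : Counters} : Rel (e + f) s s' ↔ Rel e s s' ∨ Rel f s s' := by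
  constructor
  · rintro ⟨w, hw | hw, h⟩
    · exact Or.inl ⟨w, hw, h⟩
    · exact Or.inr ⟨w, hw, h⟩
  · rintro (⟨w, hw, h⟩ | ⟨w, hw, h⟩)
    · exact ⟨w, Or.inl hw, h⟩
    · exact ⟨w, Or.inr hw, h⟩

theorem rel_mul {e f : Program} {s s' : Counters} :
    Rel (e * f) s s' ↔ ∃ t, Rel e s t ∧ Rel f t s' := by
  constructor
  · rintro ⟨w, hw, h⟩
    rw [matches'_mul, Language.mem_mul] at hw
    obtain ⟨u, hu, v, hv, rfl⟩ := hw
    obtain ⟨t, h1, h2⟩ := Op.exec_append.1 h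
    exact ⟨t, ⟨u, hu, h1⟩, v, hv, h2⟩
  · rintro ⟨t, ⟨u, hu, h1⟩, v, hv, h2⟩
    exact ⟨u ++ v, by rw [matches'_mul]; exact Language.append_mem_mul hu hv,
      Op.exec_append.2 ⟨t, h1, h2⟩⟩

theorem rel_star {e : Program} {s s' : Counters} :
    Rel e.star s s' ↔ Relation.ReflTransGen (Rel e) s s' := by
  constructor
  · rintro ⟨w, hw, h⟩
    rw [matches'_star, Language.mem_kstar] at hw
    obtain ⟨L, rfl, hL⟩ := hw
    induction L generalizing s with
    | nil => obtain rfl : s' = s := h; exact .refl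
    | cons u L ih =>
      obtain ⟨t, h1, h2⟩ := Op.exec_append.1 (by simpa using h)
      exact .head ⟨u, hL u (by simp), h1⟩ (ih (fun v hv => hL v (by simp [hv])) h2)
  · intro h
    induction h using Relation.ReflTransGen.head_induction_on with
    | refl => exact ⟨[], by rw [matches'_star]; exact Language.nil_mem_kstar _, rfl⟩
    | head h1 _ ih =>
      obtain ⟨u, hu, h1⟩ := h1
      obtain ⟨v, hv, h2⟩ := ih
      refine ⟨u ++ v, ?_, Op.exec_append.2 ⟨_, h1, h2⟩⟩
      rw [matches'_star, Language.mem_kstar] at hv ⊢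
      obtain ⟨L, rfl, hL⟩ := hv
      exact ⟨u :: L, by simp, by simpa using ⟨hu, hL⟩⟩

/-- Repeated incrementation. -/
theorem rel_star_inc {r : ℕ} {s s' : Counters} :
    Rel (char (Op.inc r)).star s s' ↔ ∃ k : ℕ, s' = Function.update s r (s r + k) := by
  rw [rel_star]
  constructor
  · intro h
    induction h with
    | refl => exact ⟨0, by simp⟩
    | tail _ h ih =>
      obtain ⟨k, rfl⟩ := ih
      obtain ⟨-, rfl⟩ := rel_char.1 h
      exact ⟨k + 1, by simp [Op.act, add_assoc]⟩
  · rintro ⟨k, rfl⟩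
    induction k with
    | zero => simpa using Relation.ReflTransGen.refl
    | succ k ih =>
      exact ih.tail (rel_char.2 ⟨trivial, by simp [Op.act, add_assoc]⟩)

/-- The program that gives an arbitrary value to the counter `r + 1`. -/
def guess (r : ℕ) : Program := (char (Op.inc (r + 1)) + char (Op.dec r)).star

theorem rel_guess {r : ℕ} {s s' : Counters} :
    Rel (guess r) s s' ↔ ∃ x : ℤ, s' = Function.update s (r + 1) x := by
  rw [guess, rel_star]
  constructor
  · intro h
    induction h with
    | refl => exact ⟨s (r + 1), by simp⟩
    | tail _ h ih =>
      obtain ⟨x, rfl⟩ := ih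
      rcases rel_add.1 h with h | h <;> obtain ⟨-, rfl⟩ := rel_char.1 h
      · exact ⟨x + 1, by simp [Op.act]⟩
      · exact ⟨x - 1, by simp [Op.act]⟩
  · rintro ⟨x, rfl⟩
    obtain ⟨d, rfl⟩ : ∃ d, x = s (r + 1) + d := ⟨x - s (r + 1), by ring⟩
    induction d using Int.induction_on with
    | zero => simpa using Relation.ReflTransGen.refl
    | succ k ih =>
      exact ih.tail (rel_add.2 (Or.inl (rel_char.2 ⟨trivial, by simp [Op.act, add_assoc]⟩)))
    | pred k ih =>
      exact ih.tail (rel_add.2 (Or.inr (rel_char.2 ⟨trivial, by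
        simp [Op.act, add_sub_assoc]⟩)))

/-! ### Guess-and-verify programs for primitive recursive functions. -/

/-- Two contents of the counters agree below `K`. -/
def Agree (K : ℕ) (s s' : Counters) : Prop := ∀ i < K, s' i = s i

theorem Agree.refl (K : ℕ) (s : Counters) : Agree K s s := fun _ _ => rfl

theorem Agree.trans {K : ℕ} {s t u : Counters} (h : Agree K s t) (h' : Agree K t u) :
    Agree K s u := fun i hi => (h' i hi).trans (h i hi)

theorem Agree.mono {K L : ℕ} {s t : Counters} (h : Agree L s t) (hKL : K ≤ L) : Agree K s t :=
  fun i hi => h i (hi.trans_le hKL)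

theorem Agree.update {K : ℕ} {s t : Counters} (h : Agree K s t) {r : ℕ} (hr : K ≤ r) (x : ℤ) :
    Agree K s (Function.update t r x) := fun i hi => by
  rw [Function.update_of_ne (by omega)]
  exact h i hi

/-- If the counters `ρ i` contain `v`, then the program `e` leaves the counters below `K` as they
are, and can be executed if and only if the counter `o` contains `f v`. -/
def Checks (e : Program) (K : ℕ) {n : ℕ} (ρ : Fin n → ℕ) (o : ℕ) (f : List.Vector ℕ n → ℕ) : Prop :=
  ∀ s v, (∀ i, s (ρ i) = v.get i) →
    (∀ s', Rel e s s' → Agree K s s' ∧ s o = f v) ∧ (s o = f v → ∃ s', Rel e s s')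

/-- Prepares compositions: the values `g i v` are guessed one after the other into the counters from
`K` on, each being verified by a program whose scratch space begins above it. Correct guesses exist,
so the program can always be executed. -/
theorem exists_checks_forall {m n : ℕ} (g : Fin n → List.Vector ℕ m → ℕ)
    (hg : ∀ i K ρ o, 0 < K → (∀ i, ρ i < K) → o < K → ∃ e, Checks e K ρ o (g i))
    (K : ℕ) (ρ : Fin m → ℕ) (hK : 0 < K) (hρ : ∀ i, ρ i < K) (j : ℕ) (hj : j ≤ n) :
    ∃ e : Program, ∀ s v, (∀ i, s (ρ i) = v.get i) →
      (∀ s', Rel e s s' → Agree K s s' ∧ ∀ i : Fin n, i < j → s' (K + i) = g i v) ∧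
      ∃ s', Rel e s s' := by
  induction j with
  | zero => exact ⟨1, fun s v _ => ⟨fun s' h => ⟨by rw [rel_one.1 h]; exact .refl _ _, by simp⟩,
      s, rel_one.2 rfl⟩⟩
  | succ j ih =>
    obtain ⟨e, he⟩ := ih (by omega)
    obtain ⟨f, hf⟩ := hg ⟨j, hj⟩ (K + j + 1) ρ (K + j) (by omega) (fun i => by have := hρ i; omega)
      (by omega)
    -- `guess r` writes to the counter `r + 1`, so the index `K` has to be a successor; this is the
    -- role of `0 < K`.
    obtain ⟨k, rfl⟩ : ∃ k, K = k + 1 := ⟨K - 1, by omega⟩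
    have hkj : k + j + 1 = k + 1 + j := by omega
    refine ⟨e * (guess (k + j) * f), fun s v hv => ⟨fun s' h => ?_, ?_⟩⟩
    · obtain ⟨t, ht, h⟩ := rel_mul.1 h
      obtain ⟨t', ht', h⟩ := rel_mul.1 h
      obtain ⟨x, rfl⟩ := rel_guess.1 ht'
      obtain ⟨h1, h2⟩ := (he s v hv).1 t ht
      have hst : Agree (k + 1) s (Function.update t (k + j + 1) x) := h1.update (by omega) x
      obtain ⟨h3, h4⟩ := (hf _ v fun i => by rw [hst _ (hρ i), hv]).1 s' h
      refine ⟨hst.trans (h3.mono (by omega)), fun i hi => ?_⟩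
      rw [h3 _ (by omega)]
      rcases Nat.lt_succ_iff_lt_or_eq.1 hi with hi | hi
      · rw [Function.update_of_ne (by omega)]
        exact h2 i hi
      · obtain rfl : i = ⟨j, hj⟩ := Fin.ext hi
        exact h4
    · obtain ⟨h1, t, ht⟩ := he s v hv
      have hst : Agree (k + 1) s (Function.update t (k + j + 1) (g ⟨j, hj⟩ v)) :=
        (h1 t ht).1.update (by omega) _
      obtain ⟨s', hs'⟩ := (hf (Function.update t (k + j + 1) (g ⟨j, hj⟩ v)) v
        fun i => by rw [hst _ (hρ i), hv]).2 (by rw [← hkj, Function.update_self])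
      exact ⟨s', rel_mul.2 ⟨t, ht, rel_mul.2 ⟨_, rel_guess.2 ⟨_, rfl⟩, hs'⟩⟩⟩

/-- The argument must not be changed, so a scratch copy is guessed, compared with it, incremented
and compared with `o`. -/
theorem exists_checks_succ (K : ℕ) (ρ : Fin 1 → ℕ) (o : ℕ) (hK : 0 < K) (hρ : ∀ i, ρ i < K)
    (ho : o < K) : ∃ e, Checks e K ρ o fun v => v.head.succ := by
  obtain ⟨k, rfl⟩ : ∃ k, K = k + 1 := ⟨K - 1, by omega⟩
  have h0 := hρ 0
  refine ⟨guess k * (char (.eq (k + 1) (ρ 0)) * (char (.inc (k + 1)) * char (.eq (k + 1) o))),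
    fun s v hv => ⟨fun s' h => ?_, fun h => ?_⟩⟩
  · obtain ⟨_, ht, h⟩ := rel_mul.1 h
    obtain ⟨x, rfl⟩ := rel_guess.1 ht
    obtain ⟨_, ht, h⟩ := rel_mul.1 h
    obtain ⟨h1, rfl⟩ := rel_char.1 ht
    obtain ⟨_, ht, h⟩ := rel_mul.1 h
    obtain ⟨-, rfl⟩ := rel_char.1 ht
    obtain ⟨h2, rfl⟩ := rel_char.1 h
    refine ⟨(((Agree.refl _ _).update le_rfl _).update le_rfl _), ?_⟩
    have hn : ∀ i < k + 1, i ≠ k + 1 := fun i hi => by omega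
    simp only [Op.Enabled, Op.act, Function.update_self, Function.update_of_ne (hn _ h0),
      Function.update_of_ne (hn _ ho), hv] at h1 h2
    rw [← h2, h1, ← Nat.cast_succ, List.Vector.get_zero]
  · refine ⟨_, rel_mul.2 ⟨_, rel_guess.2 ⟨s (ρ 0), rfl⟩, rel_mul.2 ⟨_, rel_char.2 ⟨?_, rfl⟩,
      rel_mul.2 ⟨_, rel_char.2 ⟨trivial, rfl⟩, rel_char.2 ⟨?_, rfl⟩⟩⟩⟩⟩
    · have : ρ 0 ≠ k + 1 := by omega
      simp [Op.Enabled, this]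
    · have : o ≠ k + 1 := by omega
      simp only [Op.Enabled, Op.act, Function.update_self, Function.update_of_ne this, hv, h]
      rw [← Nat.cast_succ, List.Vector.get_zero]

theorem exists_checks_comp {m n : ℕ} {f : List.Vector ℕ n → ℕ} (g : Fin n → List.Vector ℕ m → ℕ)
    (hf : ∀ K ρ o, 0 < K → (∀ i, ρ i < K) → o < K → ∃ e, Checks e K ρ o f)
    (hg : ∀ i K ρ o, 0 < K → (∀ i, ρ i < K) → o < K → ∃ e, Checks e K ρ o (g i))
    (K : ℕ) (ρ : Fin m → ℕ) (o : ℕ) (hK : 0 < K) (hρ : ∀ i, ρ i < K) (ho : o < K) :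
    ∃ e, Checks e K ρ o fun a => f (List.Vector.ofFn fun i => g i a) := by
  obtain ⟨e, he⟩ := exists_checks_forall g hg K ρ hK hρ n le_rfl
  obtain ⟨d, hd⟩ := hf (K + n) (fun i => K + i) o (by omega) (fun i => by simp) (by omega)
  refine ⟨e * d, fun s v hv => ⟨fun s' h => ?_, fun h => ?_⟩⟩
  · obtain ⟨t, ht, h⟩ := rel_mul.1 h
    obtain ⟨h1, h2⟩ := (he s v hv).1 t ht
    obtain ⟨h3, h4⟩ := (hd t (List.Vector.ofFn fun i => g i v) fun i => by
      simpa using h2 i i.2).1 s' h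
    exact ⟨h1.trans (h3.mono (by omega)), by rw [← h1 _ ho, h4]⟩
  · obtain ⟨h1, t, ht⟩ := he s v hv
    obtain ⟨h1, h2⟩ := h1 t ht
    obtain ⟨s', hs'⟩ := (hd t (List.Vector.ofFn fun i => g i v) fun i => by
      simpa using h2 i i.2).2 (by rw [h1 _ ho, h])
    exact ⟨s', rel_mul.2 ⟨t, ht, hs'⟩⟩

/-- A loop with index `i`, accumulator `a` and next value `b`, all above the protected counters. The
loop is a Kleene star that may stop anywhere; the final test that `i` equals the recursion argument
discards the executions that stop at the wrong time. -/
theorem exists_checks_prec {n : ℕ} {f : List.Vector ℕ n → ℕ} {g : List.Vector ℕ (n + 2) → ℕ}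
    (hf : ∀ K ρ o, 0 < K → (∀ i, ρ i < K) → o < K → ∃ e, Checks e K ρ o f)
    (hg : ∀ K ρ o, 0 < K → (∀ i, ρ i < K) → o < K → ∃ e, Checks e K ρ o g)
    (K : ℕ) (ρ : Fin (n + 1) → ℕ) (o : ℕ) (hK : 0 < K) (hρ : ∀ i, ρ i < K) (ho : o < K) :
    ∃ e, Checks e K ρ o fun v => v.head.rec (f v.tail) fun y IH => g (y ::ᵥ IH ::ᵥ v.tail) := by
  obtain ⟨k, rfl⟩ : ∃ k, K = k + 1 := ⟨K - 1, by omega⟩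
  set i := k + 1 with hi
  set a := k + 2 with ha
  set b := k + 3 with hb
  obtain ⟨d, hd⟩ := hf (k + 4) (fun j => ρ j.succ) a (by omega)
    (fun j => by have := hρ j.succ; omega) (by omega)
  obtain ⟨e, he⟩ := hg (k + 4) (Fin.cons i (Fin.cons a fun j => ρ j.succ)) b (by omega)
    (fun j => by
      refine Fin.cases ?_ (fun j => Fin.cases ?_ (fun j => ?_) j) j
      · simp [hi]
      · simp [ha]
      · have := hρ j.succ
        simp only [Fin.cons_succ]
        omega) (by omega)
  set F : List.Vector ℕ (n + 1) → ℕ → ℕ := fun v x =>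
    x.rec (f v.tail) fun y IH => g (y ::ᵥ IH ::ᵥ v.tail) with hF
  -- Guess `b` and let `e` verify it as the value of `g` at `i`, `a` and the parameters; then copy
  -- `b` into `a` by guessing and comparing, and increment `i`.
  let body : Program :=
    guess (k + 2) * (e * (guess (k + 1) * (char (.eq a b) * char (.inc i))))
  have hregs : ∀ (s : Counters) (v : List.Vector ℕ (n + 1)) (t : Counters) (x : ℕ),
      (∀ j, s (ρ j) = v.get j) → Agree (k + 1) s t → t i = x → t a = F v x →
      ∀ j, t ((Fin.cons i (Fin.cons a fun j => ρ j.succ) : Fin (n + 2) → ℕ) j) =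
        (x ::ᵥ F v x ::ᵥ v.tail).get j := by
    intro s v t x hv hst h1 h2 j
    refine Fin.cases ?_ (fun j => Fin.cases ?_ (fun j => ?_) j) j
    · simpa using h1
    · rw [Fin.cons_succ, Fin.cons_zero, List.Vector.get_cons_succ, List.Vector.get_cons_zero]
      exact h2
    · simp [hst _ (hρ _), hv]
  -- Soundness: every execution of the body preserves the invariant that `a` holds the value of the
  -- recursion at `i`.
  have hbody1 : ∀ s v t t', (∀ j, s (ρ j) = v.get j) → Agree (k + 1) s t → (∃ x : ℕ, t i = x ∧
      t a = F v x) → Rel body t t' → Agree (k + 1) s t' ∧ ∃ x : ℕ, t' i = x ∧ t' a = F v x := by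
    rintro s v t t' hv hst ⟨x, hx1, hx2⟩ h
    obtain ⟨_, ht, h⟩ := rel_mul.1 h
    obtain ⟨y, rfl⟩ := rel_guess.1 ht
    obtain ⟨t₁, ht₁, h⟩ := rel_mul.1 h
    obtain ⟨_, ht, h⟩ := rel_mul.1 h
    obtain ⟨z, rfl⟩ := rel_guess.1 ht
    obtain ⟨_, ht, h⟩ := rel_mul.1 h
    obtain ⟨h1, rfl⟩ := rel_char.1 ht
    obtain ⟨-, rfl⟩ := rel_char.1 h
    have hst' := hst.update (r := k + 2 + 1) (by omega) y
    obtain ⟨h2, h3⟩ := (he _ _ (hregs s v _ x hv hst'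
      (by rw [Function.update_of_ne (by omega), hx1])
      (by rw [Function.update_of_ne (by omega), hx2]))).1 _ ht₁
    have hst₁ := hst'.trans (h2.mono (by omega))
    refine ⟨(hst₁.update (by omega) _).update (by omega) _, x + 1, ?_, ?_⟩
    · simp only [Op.act, Function.update_self]
      rw [Function.update_of_ne (by omega), h2 _ (by omega), Function.update_of_ne (by omega), hx1]
      push_cast
      rfl
    · have h1' : z = t₁ b := by
        simp only [Op.Enabled] at h1
        rwa [show a = k + 1 + 1 from rfl, Function.update_self,
          Function.update_of_ne (by omega)] at h1
      simp only [Op.act]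
      rw [Function.update_of_ne (by omega), show a = k + 1 + 1 from rfl, Function.update_self,
        h1', h2 _ (by omega), h3]
  -- Progress: with the right guesses the body can be executed, and advances `i` by one.
  have hbody2 : ∀ s v t, (∀ j, s (ρ j) = v.get j) → ∀ x : ℕ, Agree (k + 1) s t → t i = x →
      t a = F v x → ∃ t', Rel body t t' ∧ t' i = ((x + 1 : ℕ) : ℤ) := by
    intro s v t hv x hst hx1 hx2
    have hst' := hst.update (r := k + 2 + 1) (by omega) (F v (x + 1))
    obtain ⟨t₁, ht₁⟩ := (he _ _ (hregs s v _ x hv hst'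
      (by rw [Function.update_of_ne (by omega), hx1])
      (by rw [Function.update_of_ne (by omega), hx2]))).2 (by
        rw [show b = k + 2 + 1 from rfl, Function.update_self])
    have h2 := ((he _ _ (hregs s v _ x hv hst'
      (by rw [Function.update_of_ne (by omega), hx1])
      (by rw [Function.update_of_ne (by omega), hx2]))).1 _ ht₁).1
    refine ⟨_, rel_mul.2 ⟨_, rel_guess.2 ⟨_, rfl⟩, rel_mul.2 ⟨t₁, ht₁, rel_mul.2 ⟨_,
      rel_guess.2 ⟨t₁ b, rfl⟩, rel_mul.2 ⟨_, rel_char.2 ⟨?_, rfl⟩, rel_char.2 ⟨trivial, rfl⟩⟩⟩⟩⟩, ?_⟩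
    · simp only [Op.Enabled]
      rw [show a = k + 1 + 1 from rfl, Function.update_self, Function.update_of_ne (by omega)]
    · simp only [Op.act, Function.update_self]
      rw [Function.update_of_ne (by omega), h2 _ (by omega), Function.update_of_ne (by omega), hx1]
      push_cast
      rfl
  refine ⟨guess k * (char (.zero i) * (guess (k + 1) * (d * (body.star *
    (char (.eq i (ρ 0)) * char (.eq a o)))))), fun s v hv => ⟨fun s' h => ?_, fun h => ?_⟩⟩
  · obtain ⟨_, k₁, h'₁⟩ := rel_mul.1 h
    obtain ⟨x, rfl⟩ := rel_guess.1 k₁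
    obtain ⟨_, k₂, h'₂⟩ := rel_mul.1 h'₁
    obtain ⟨h1, rfl⟩ := rel_char.1 k₂
    obtain ⟨_, k₃, h'₃⟩ := rel_mul.1 h'₂
    obtain ⟨y, rfl⟩ := rel_guess.1 k₃
    obtain ⟨t₁, ht₁, h'₄⟩ := rel_mul.1 h'₃
    obtain ⟨t₂, ht₂, h'₅⟩ := rel_mul.1 h'₄
    obtain ⟨t₃, k₄, h'₆⟩ := rel_mul.1 h'₅
    obtain ⟨h3, e3⟩ := rel_char.1 k₄
    obtain ⟨h4, e4⟩ := rel_char.1 h'₆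
    rw [show t₃ = t₂ from e3] at h4 e4
    rw [show s' = t₂ from e4]
    simp only [Op.Enabled, Op.act, hi, Function.update_self] at h1 h3 h4 ht₁
    subst h1
    have hst : Agree (k + 1) s (Function.update (Function.update s (k + 1) 0) (k + 1 + 1) y) :=
      ((Agree.refl _ _).update (by omega) _).update (by omega) _
    obtain ⟨h5, h6⟩ := (hd _ v.tail (fun j => by simp [hst _ (hρ _), hv])).1 _ ht₁
    have inv : ∀ t, Relation.ReflTransGen (Rel body) t₁ t →
        Agree (k + 1) s t ∧ ∃ x : ℕ, t i = x ∧ t a = F v x := by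
      intro t ht
      induction ht with
      | refl =>
        refine ⟨hst.trans (h5.mono (by omega)), 0, ?_, ?_⟩
        · rw [h5 _ (by omega)]
          simp [hi]
        · rw [h5 _ (by omega)]
          exact h6
      | tail _ h ih => exact hbody1 s v _ _ hv ih.1 ih.2 h
    obtain ⟨i1, x, i2, i3⟩ := inv t₂ (rel_star.1 ht₂)
    refine ⟨i1, ?_⟩
    rw [← i1 _ ho, ← h4, i3]
    rw [i2, i1 _ (hρ 0), hv 0, List.Vector.get_zero] at h3
    rw [Nat.cast_inj.1 h3]
  · set s₁ := Function.update (Function.update s (k + 1) 0) (k + 1 + 1) (F v 0 : ℤ) with hs₁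
    have hst : Agree (k + 1) s s₁ :=
      ((Agree.refl _ _).update (by omega) _).update (by omega) _
    have hd1 := hd s₁ v.tail (fun j => by simp [hst _ (hρ _), hv])
    obtain ⟨t₁, ht₁⟩ := hd1.2 (by simp [hs₁, ha, hF])
    obtain ⟨h5, h6⟩ := hd1.1 _ ht₁
    -- Progress gives the new value of `i`; soundness then gives the value of `a` belonging to it.
    have loop : ∀ x : ℕ, ∃ t, Rel body.star t₁ t ∧ Agree (k + 1) s t ∧ t i = x ∧ t a = F v x := by
      intro x
      induction x with
      | zero =>
        refine ⟨t₁, rel_star.2 .refl, hst.trans (h5.mono (by omega)), ?_, ?_⟩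
        · rw [h5 _ (by omega)]
          rw [hs₁, Function.update_of_ne (by omega), hi, Function.update_self, Nat.cast_zero]
        · rw [h5 _ (by omega)]
          exact h6
      | succ x ih =>
        obtain ⟨t, h1, h2, h3, h4⟩ := ih
        obtain ⟨t', h7, h8⟩ := hbody2 s v t hv x h2 h3 h4
        obtain ⟨h9, y, hy1, hy2⟩ := hbody1 s v t t' hv h2 ⟨x, h3, h4⟩ h7
        refine ⟨t', rel_star.2 ((rel_star.1 h1).tail h7), h9, h8, ?_⟩
        rw [h8] at hy1
        rw [hy2, ← Nat.cast_inj.1 hy1]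
    obtain ⟨t, h1, h2, h3, h4⟩ := loop v.head
    refine ⟨t, rel_mul.2 ⟨_, rel_guess.2 ⟨0, rfl⟩, rel_mul.2 ⟨_, rel_char.2 ⟨?_, rfl⟩,
      rel_mul.2 ⟨_, rel_guess.2 ⟨F v 0, rfl⟩, rel_mul.2 ⟨t₁, ht₁, rel_mul.2 ⟨t, h1,
      rel_mul.2 ⟨_, rel_char.2 ⟨?_, rfl⟩, rel_char.2 ⟨?_, rfl⟩⟩⟩⟩⟩⟩⟩⟩
    · simp [Op.Enabled, hi]
    · simp only [Op.Enabled]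
      rw [h3, h2 _ (hρ 0), hv 0, List.Vector.get_zero]
    · simp only [Op.Enabled, Op.act]
      rw [h4, h2 _ ho, h]

/-- `K`, `ρ` and `o` are universally quantified in the induction hypothesis because subprograms are
used with other registers and higher scratch space. -/
theorem exists_checks {n : ℕ} {f : List.Vector ℕ n → ℕ} (hf : Nat.Primrec' f) :
    ∀ K ρ o, 0 < K → (∀ i, ρ i < K) → o < K → ∃ e, Checks e K ρ o f := by
  induction hf with
  | zero =>
    intro K ρ o hK hρ ho
    refine ⟨char (.zero o), fun s v hv => ⟨fun s' h => ?_, fun h => ⟨s, rel_char.2 ⟨h, rfl⟩⟩⟩⟩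
    obtain ⟨h, rfl⟩ := rel_char.1 h
    exact ⟨.refl _ _, h⟩
  | succ => exact exists_checks_succ
  | get j =>
    intro K ρ o hK hρ ho
    refine ⟨char (.eq o (ρ j)), fun s v hv => ⟨fun s' h => ?_, fun h => ⟨s, rel_char.2 ⟨?_, rfl⟩⟩⟩⟩
    · obtain ⟨h, rfl⟩ := rel_char.1 h
      exact ⟨.refl _ _, by rw [← hv j]; exact h⟩
    · change s o = s (ρ j)
      rw [h, hv j]
  | comp g _ _ hf hg => exact exists_checks_comp g hf hg
  | prec _ _ hf hg => exact exists_checks_prec hf hg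

/-- A projection of a primitive recursive relation is accepted by some counter program that starts
with empty counters and guesses the argument into the counter `0`. -/
theorem exists_program {f : ℕ → ℕ → ℕ} (hf : Primrec₂ f) :
    ∃ e : Program, ∀ n : ℕ, (∃ k, f k n = 0) ↔ ∃ s', Rel e (fun _ => 0) s' ∧ s' 0 = n := by
  -- The counter 0 holds `n` and the counter 1 holds `k`. The output counter 2 still has its initial
  -- content 0 when `e` starts, so the check is that `f k n = 0`.
  obtain ⟨e, he⟩ := exists_checks (Nat.Primrec'.prim_iff₂.2 hf) 3 ![1, 0] 2 (by omega)
    (fun i => by fin_cases i <;> simp) (by omega)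
  have hget : ∀ (k n : ℕ) (i : Fin 2), Function.update (Function.update (fun _ => (0 : ℤ)) 0 n) 1 k
      (![1, 0] i) = ((k ::ᵥ n ::ᵥ List.Vector.nil : List.Vector ℕ 2).get i : ℤ) := by
    intro k n i
    fin_cases i
    · simp
    · rfl
  refine ⟨(char (.inc 0)).star * ((char (.inc 1)).star * e), fun n => ⟨?_, ?_⟩⟩
  · rintro ⟨k, hk⟩
    obtain ⟨s', hs'⟩ := (he _ _ (hget k n)).2 (by simp [hk])
    have hag := ((he _ _ (hget k n)).1 s' hs').1
    refine ⟨s', rel_mul.2 ⟨_, rel_star_inc.2 ⟨n, rfl⟩, rel_mul.2 ⟨_, rel_star_inc.2 ⟨k, rfl⟩, ?_⟩⟩, ?_⟩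
    · simpa using hs'
    · rw [hag 0 (by omega)]
      simp
  · rintro ⟨s', h, hn⟩
    obtain ⟨_, ht, h⟩ := rel_mul.1 h
    obtain ⟨m, rfl⟩ := rel_star_inc.1 ht
    obtain ⟨_, ht, h⟩ := rel_mul.1 h
    obtain ⟨k, rfl⟩ := rel_star_inc.1 ht
    simp only [zero_add, ne_eq, one_ne_zero, not_false_eq_true, Function.update_of_ne] at h
    obtain ⟨hag, h0⟩ := (he _ _ (hget k m)).1 s' h
    have hm := hag 0 (by omega)
    simp only [ne_eq, zero_ne_one, not_false_eq_true, Function.update_of_ne,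
      Function.update_self] at hm
    obtain rfl : m = n := by exact_mod_cast hm.symm.trans hn
    refine ⟨k, ?_⟩
    simpa using h0.symm

end Program

/-! ## Regular expressions have finite automata -/

section Regular

open Language Computability

variable {α : Type}

/-- Finiteness of the set of left quotients: the quotient of `L * M` by `x` is `x⁻¹L * M` together
with those `z⁻¹M` for which `x = y ++ z` and `y ∈ L`. Both ingredients range over finite sets. -/
theorem isRegular_mul {L M : Language α} (hL : L.IsRegular) (hM : M.IsRegular) :
    (L * M).IsRegular := by
  refine Language.IsRegular.of_finite_range_leftQuotient ?_
  have h1 := hL.finite_range_leftQuotient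
  have h2 := hM.finite_range_leftQuotient.finite_subsets
  refine (Set.Finite.image2 (fun (A : Language α) (S : Set (Language α)) => A * M + sSup S)
    h1 h2).subset ?_
  rintro _ ⟨x, rfl⟩
  refine ⟨_, ⟨x, rfl⟩, {N | ∃ y z, y ∈ L ∧ y ++ z = x ∧ N = M.leftQuotient z}, ?_, ?_⟩
  · rintro _ ⟨y, z, -, -, rfl⟩
    exact ⟨z, rfl⟩
  · ext u
    simp only [Language.mem_add, Language.mem_mul, Language.mem_leftQuotient]
    constructor
    · rintro (⟨a, ha, b, hb, rfl⟩ | ⟨_, ⟨y, z, hy, rfl, rfl⟩, hu⟩)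
      · exact ⟨x ++ a, ha, b, hb, by simp⟩
      · exact ⟨y, hy, z ++ u, hu, by simp⟩
    · rintro ⟨a, ha, b, hb, hab⟩
      rcases List.append_eq_append_iff.1 hab with ⟨c, rfl, rfl⟩ | ⟨c, rfl, rfl⟩
      · exact Or.inr ⟨_, ⟨a, c, ha, rfl, rfl⟩, hb⟩
      · exact Or.inl ⟨c, ha, b, hb, rfl⟩

theorem append_mem_kstar {L : Language α} {u v : List α} (hu : u ∈ L∗) (hv : v ∈ L∗) :
    u ++ v ∈ L∗ := by
  rw [Language.mem_kstar] at hu hv ⊢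
  obtain ⟨S, rfl, hS⟩ := hu
  obtain ⟨T, rfl, hT⟩ := hv
  refine ⟨S ++ T, by simp, fun y hy => ?_⟩
  rcases List.mem_append.1 hy with hy | hy
  · exact hS y hy
  · exact hT y hy

theorem mem_kstar_of_mem {L : Language α} {u : List α} (hu : u ∈ L) : u ∈ L∗ :=
  Language.mem_kstar.2 ⟨[u], by simp, by simpa using hu⟩

/-- Either `x` consumes the whole word, or the cut between `x` and `u` belongs to a factor `z ++ a`
of the decomposition, with `z` a suffix of `x` and `a` a prefix of `u`. -/
theorem append_mem_kstar_iff {L : Language α} {x u : List α} :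
    x ++ u ∈ L∗ ↔ (x ∈ L∗ ∧ u = []) ∨
      ∃ y z a b, y ∈ L∗ ∧ y ++ z = x ∧ z ++ a ∈ L ∧ b ∈ L∗ ∧ u = a ++ b := by
  constructor
  · intro h
    rw [Language.mem_kstar] at h
    obtain ⟨S, hS, hL⟩ := h
    induction S generalizing x with
    | nil =>
      simp only [List.flatten_nil, List.append_eq_nil_iff] at hS
      obtain ⟨rfl, rfl⟩ := hS
      exact Or.inl ⟨Language.nil_mem_kstar _, rfl⟩
    | cons w S ih =>
      have hw := hL w (by simp)
      have hS' : S.flatten ∈ L∗ := Language.mem_kstar.2 ⟨S, rfl, fun y hy => hL y (by simp [hy])⟩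
      rw [List.flatten_cons] at hS
      rcases List.append_eq_append_iff.1 hS with ⟨c, rfl, rfl⟩ | ⟨c, rfl, hc⟩
      · exact Or.inr ⟨[], x, c, _, Language.nil_mem_kstar _, rfl, hw, hS', rfl⟩
      · rcases ih hc.symm (fun y hy => hL y (by simp [hy])) with
          ⟨h1, h2⟩ | ⟨y, z, a, b, hy, rfl, hz, hb, rfl⟩
        · exact Or.inl ⟨append_mem_kstar (mem_kstar_of_mem hw) h1, h2⟩
        · exact Or.inr ⟨w ++ y, z, a, b, append_mem_kstar (mem_kstar_of_mem hw) hy, by simp, hz,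
            hb, rfl⟩
  · rintro (⟨h, rfl⟩ | ⟨y, z, a, b, hy, rfl, hz, hb, rfl⟩)
    · simpa using h
    · have := append_mem_kstar hy (append_mem_kstar (mem_kstar_of_mem hz) hb)
      simpa using this

/-- The quotient of `L∗` by `x` is a union of quotients `z⁻¹L`, followed by `L∗`, plus the empty
word if `x ∈ L∗`; this leaves finitely many possibilities. -/
theorem isRegular_kstar {L : Language α} (hL : L.IsRegular) : (L∗).IsRegular := by
  refine Language.IsRegular.of_finite_range_leftQuotient ?_
  have h2 := hL.finite_range_leftQuotient.finite_subsets
  refine (Set.Finite.image2 (fun (E : Language α) (S : Set (Language α)) => E + sSup S * L∗)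
    (Set.toFinite {0, 1}) h2).subset ?_
  rintro _ ⟨x, rfl⟩
  have key : ∀ u, u ∈ sSup {N | ∃ y z, y ∈ L∗ ∧ y ++ z = x ∧ N = L.leftQuotient z} * L∗ ↔
      ∃ y z a b, y ∈ L∗ ∧ y ++ z = x ∧ z ++ a ∈ L ∧ b ∈ L∗ ∧ u = a ++ b := by
    intro u
    rw [Language.mem_mul]
    constructor
    · rintro ⟨a, ⟨_, ⟨y, z, hy, hyz, rfl⟩, ha⟩, b, hb, rfl⟩
      exact ⟨y, z, a, b, hy, hyz, ha, hb, rfl⟩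
    · rintro ⟨y, z, a, b, hy, hyz, ha, hb, rfl⟩
      exact ⟨a, ⟨_, ⟨y, z, hy, hyz, rfl⟩, ha⟩, b, hb, rfl⟩
  have hsub : {N | ∃ y z, y ∈ L∗ ∧ y ++ z = x ∧ N = L.leftQuotient z} ⊆
      Set.range L.leftQuotient := by
    rintro _ ⟨y, z, -, -, rfl⟩
    exact ⟨z, rfl⟩
  by_cases hx : x ∈ (L∗)
  · refine ⟨1, by simp, _, hsub, ?_⟩
    ext u
    rw [Language.mem_leftQuotient, append_mem_kstar_iff, Language.mem_add, key, Language.mem_one]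
    simp [hx]
  · refine ⟨0, by simp, _, hsub, ?_⟩
    ext u
    rw [Language.mem_leftQuotient, append_mem_kstar_iff, Language.mem_add, key]
    simp [hx, Language.notMem_zero]

theorem isRegular_singleton (a : α) : ({[a]} : Language α).IsRegular := by
  refine Language.IsRegular.of_finite_range_leftQuotient ?_
  refine (Set.toFinite ({{[a]}, 1, 0} : Set (Language α))).subset ?_
  rintro _ ⟨x, rfl⟩
  rcases x with _ | ⟨b, _ | ⟨c, x⟩⟩
  · exact Or.inl rfl
  · by_cases h : b = a
    · refine Or.inr (Or.inl ?_)
      ext u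
      change [b] ++ u = [a] ↔ u = []
      simp [h]
    · refine Or.inr (Or.inr ?_)
      ext u
      change [b] ++ u = [a] ↔ False
      simp [h]
  · refine Or.inr (Or.inr ?_)
    ext u
    change b :: c :: x ++ u = [a] ↔ False
    simp

theorem isRegular_zero : (0 : Language α).IsRegular := by
  refine Language.IsRegular.of_finite_range_leftQuotient ((Set.finite_singleton 0).subset ?_)
  rintro _ ⟨x, rfl⟩
  rfl

theorem isRegular_one : (1 : Language α).IsRegular := by
  have := isRegular_kstar (isRegular_zero (α := α))
  rwa [kstar_zero] at this

theorem isRegular_matches' (e : RegularExpression α) : e.matches'.IsRegular := by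
  induction e with
  | zero => exact isRegular_zero
  | epsilon => exact isRegular_one
  | char a => exact isRegular_singleton a
  | plus e f ihe ihf => exact ihe.add ihf
  | comp e f ihe ihf => exact isRegular_mul ihe ihf
  | star e ih => exact isRegular_kstar ih

/-- The type of instructions is infinite, whereas a grammar can branch over finitely many letters
only. -/
theorem exists_finite_alphabet (e : RegularExpression α) :
    ∃ F : Set α, F.Finite ∧ ∀ w ∈ e.matches', ∀ a ∈ w, a ∈ F := by
  induction e with
  | zero => exact ⟨∅, Set.finite_empty, fun w hw => hw.elim⟩
  | epsilon =>
    refine ⟨∅, Set.finite_empty, fun w hw => ?_⟩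
    obtain rfl : w = [] := hw
    simp
  | char a =>
    refine ⟨{a}, Set.finite_singleton a, fun w hw => ?_⟩
    obtain rfl : w = [a] := hw
    simp
  | plus e f ihe ihf =>
    obtain ⟨E, hE, hE'⟩ := ihe
    obtain ⟨F, hF, hF'⟩ := ihf
    refine ⟨E ∪ F, hE.union hF, ?_⟩
    rintro w (hw | hw) a ha
    · exact Or.inl (hE' w hw a ha)
    · exact Or.inr (hF' w hw a ha)
  | comp e f ihe ihf =>
    obtain ⟨E, hE, hE'⟩ := ihe
    obtain ⟨F, hF, hF'⟩ := ihf
    refine ⟨E ∪ F, hE.union hF, fun w hw a ha => ?_⟩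
    rw [RegularExpression.comp_def, RegularExpression.matches'_mul, Language.mem_mul] at hw
    obtain ⟨u, hu, v, hv, rfl⟩ := hw
    rcases List.mem_append.1 ha with ha | ha
    · exact Or.inl (hE' u hu a ha)
    · exact Or.inr (hF' v hv a ha)
  | star e ih =>
    obtain ⟨E, hE, hE'⟩ := ih
    refine ⟨E, hE, fun w hw a ha => ?_⟩
    rw [RegularExpression.matches'_star, Language.mem_kstar] at hw
    obtain ⟨S, rfl, hS⟩ := hw
    obtain ⟨u, hu, ha⟩ := List.mem_flatten.1 ha
    exact hE' u (hS u hu) a ha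

theorem exists_dfa (e : RegularExpression α) :
    ∃ (k : ℕ) (f : Fin k → α) (m : ℕ) (D : DFA (Fin k) (Fin m)),
      ∀ w, w ∈ e.matches' ↔ ∃ v : List (Fin k), v ∈ D.accepts ∧ v.map f = w := by
  obtain ⟨F, hF, hFe⟩ := exists_finite_alphabet e
  obtain ⟨σ, _, M, hM⟩ := isRegular_matches' e
  have := hF.fintype
  let f : Fin (Fintype.card F) → α := fun i => (Fintype.equivFin F).symm i
  refine ⟨_, f, Fintype.card σ, DFA.reindex (Fintype.equivFin σ) (M.comap f), fun w => ?_⟩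
  have hacc : ∀ v, v ∈ (DFA.reindex (Fintype.equivFin σ) (M.comap f)).accepts ↔
      v.map f ∈ e.matches' := by
    intro v
    rw [DFA.accepts_reindex, DFA.accepts_comap, hM]
    rfl
  constructor
  · intro hw
    have : ∃ v : List (Fin (Fintype.card F)), v.map f = w := by
      have hw' := hFe w hw
      clear hw
      induction w with
      | nil => exact ⟨[], rfl⟩
      | cons a w ih =>
        obtain ⟨v, rfl⟩ := ih fun b hb => hw' b (by simp [hb])
        exact ⟨Fintype.equivFin F ⟨a, hw' a (by simp)⟩ :: v, by simp [f]⟩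
    obtain ⟨v, rfl⟩ := this
    exact ⟨v, (hacc v).2 hw, rfl⟩
  · rintro ⟨v, hv, rfl⟩
    exact (hacc v).1 hv

end Regular

/-! ## The grammar of an automaton -/

/-- The nodes of the generated graph. The words are read from right to left: the letter that comes
last is the head of the list. -/
inductive Node (k : ℕ) : Type
  | main (w : List (Fin k))
  | test (w : List (Fin k))
  | down (b : Bool) (w : List (Fin k))
  | mark (b : Bool) (a : Fin k) (w : List (Fin k))

/-- The colours of the generated graph. -/
inductive Colour (k : ℕ) : Type
  | main
  | root
  | acc
  | test
  | letter (a : Fin k)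
  | mark (b : Bool) (a : Fin k)
  | halt (b : Bool)
  deriving DecidableEq, Fintype

namespace Node

variable {k : ℕ}

/-- An injection of the nodes into a countable type. -/
def toTuple : Node k → ℕ × Bool × List (Fin k)
  | main w => (0, true, w)
  | test w => (1, true, w)
  | down b w => (2, b, w)
  | mark b a w => (3, b, a :: w)

theorem toTuple_injective : Function.Injective (toTuple (k := k)) := by
  rintro (w | w | ⟨b, w⟩ | ⟨b, a, w⟩) (w' | w' | ⟨b', w'⟩ | ⟨b', a', w'⟩) h <;>
    simp_all [toTuple]

instance : Countable (Node k) := toTuple_injective.countable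

/-- A numbering of the nodes. -/
noncomputable def code : Node k → ℕ := (exists_injective_nat (Node k)).choose

theorem code_injective : Function.Injective (code (k := k)) :=
  (exists_injective_nat (Node k)).choose_spec

/-- The nodes of a word that are shared with the non-terminal hyperarc of this word. -/
def ports (w : List (Fin k)) : List (Node k) := [main w, down true w, down false w]

/-- The label of the arcs that leave a node. -/
def label : Node k → Fin 3
  | main _ => 0
  | test _ => 1
  | down _ [] => 2
  | down _ (_ :: _) => 1
  | mark _ _ _ => 2

/-- The targets of the arcs that leave a node. -/
def succs : Node k → List (Node k)
  | main w => test w :: (List.finRange k).map fun a => main (a :: w)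
  | test w => [down true w, down false w]
  | down b [] => [down b []]
  | down b (a :: w) => [down b w, mark b a w]
  | mark b _ w => [down b w]

theorem nodup_succs (u : Node k) : u.succs.Nodup := by
  rcases u with w | w | ⟨b, _ | ⟨a, w⟩⟩ | ⟨b, a, w⟩
  · simp only [succs, List.nodup_cons, List.mem_map, reduceCtorEq, and_false, exists_false,
      not_false_eq_true, true_and]
    exact (List.nodup_finRange k).map fun a b h => by simpa using h
  all_goals simp [succs]

/-- The probabilities of the labels. -/
def weight (k : ℕ) : Fin 3 → ℚ := ![1 / (k + 1), 1 / 2, 1]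

theorem weight_mem (k : ℕ) (l : Fin 3) : weight k l ∈ Set.Icc (0 : ℚ) 1 := by
  have h : (1 : ℚ) / (k + 1) ≤ 1 := by
    rw [div_le_one (by positivity)]
    linarith [(Nat.cast_nonneg k : (0 : ℚ) ≤ k)]
  have h' : (0 : ℚ) ≤ 1 / (k + 1) := by positivity
  fin_cases l
  · exact ⟨h', h⟩
  · constructor <;> norm_num [weight]
  · constructor <;> norm_num [weight]

theorem weight_mul_length_succs (u : Node k) : weight k u.label * u.succs.length = 1 := by
  rcases u with w | w | ⟨b, _ | ⟨a, w⟩⟩ | ⟨b, a, w⟩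
  · have : (k : ℚ) + 1 ≠ 0 := by positivity
    simp only [weight, label, succs, Matrix.cons_val_zero, List.length_cons, List.length_map,
      List.length_finRange, Nat.cast_add, Nat.cast_one]
    field_simp
  · norm_num [weight, label, succs]
  · simp [weight, label, succs]
  · norm_num [weight, label, succs]
  · simp [weight, label, succs]

end Node

/-- The symbol of a colour. -/
noncomputable def Colour.idx {k : ℕ} (c : Colour k) : Fin (Fintype.card (Colour k)) :=
  Fintype.equivFin _ c

theorem Colour.idx_injective {k : ℕ} : Function.Injective (Colour.idx (k := k)) :=
  (Fintype.equivFin _).injective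

namespace Automaton

open Node

variable {k m : ℕ} (D : DFA (Fin k) (Fin m))

/-- Hyperarcs between nodes. -/
abbrev NodeArc (k m : ℕ) : Type :=
  Hyperarc (Fin (m + 1)) (Fin 3) (Fin (Fintype.card (Colour k))) (Node k)

/-- The state that is reached by a word. -/
def state : List (Fin k) → Fin m
  | [] => D.start
  | a :: w => D.step (state w) a

theorem state_reverse (w : List (Fin k)) : state D w.reverse = D.eval w := by
  induction w using List.reverseRecOn with
  | nil => rfl
  | append_singleton w a ih => rw [List.reverse_append, DFA.eval_append_singleton, ← ih]; rfl

open Classical in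
/-- The colour of an accepting main node. -/
noncomputable def accList (q : Fin m) (w : List (Fin k)) : List (NodeArc k m) :=
  if q ∈ D.accept then [.colour Colour.acc.idx (main w)] else []

/-- The right-hand side of the start symbol. -/
noncomputable def startRule : List (NodeArc k m) :=
  [.arc 2 (down true []) (down true []), .arc 2 (down false []) (down false []),
    .colour Colour.main.idx (main []), .colour Colour.root.idx (main []),
    .colour (Colour.halt true).idx (down true []), .colour (Colour.halt false).idx (down false []),
    .nonterm D.start.succ (ports [])] ++ accList D D.start []

/-- The hyperarcs that are created for one letter. -/
noncomputable def letterRule (q : Fin m) (a : Fin k) : List (NodeArc k m) :=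
  [.arc 0 (main []) (main [a]), .colour Colour.main.idx (main [a]),
    .colour (Colour.letter a).idx (main [a]), .nonterm (D.step q a).succ (ports [a])] ++
  accList D (D.step q a) [a] ++
  [true, false].flatMap fun b => [.arc 1 (down b [a]) (down b []),
    .arc 1 (down b [a]) (mark b a []), .arc 2 (mark b a []) (down b []),
    .colour (Colour.mark b a).idx (mark b a [])]

/-- The right-hand side of the non-terminal of a state. -/
noncomputable def stateRule (q : Fin m) : List (NodeArc k m) :=
  [.arc 0 (main []) (test []), .arc 1 (test []) (down true []), .arc 1 (test []) (down false []),
    .colour Colour.test.idx (test [])] ++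
  (List.finRange k).flatMap (letterRule D q)

/-- Membership in the right-hand side of the start symbol. -/
inductive StartRule : NodeArc k m → Prop
  | loop (b) : StartRule (.arc 2 (down b []) (down b []))
  | main : StartRule (.colour Colour.main.idx (main []))
  | root : StartRule (.colour Colour.root.idx (Node.main []))
  | halt (b) : StartRule (.colour (Colour.halt b).idx (down b []))
  | nonterm : StartRule (.nonterm D.start.succ (ports []))
  | acc (h : D.start ∈ D.accept) : StartRule (.colour Colour.acc.idx (Node.main []))

/-- Membership in the right-hand side of the non-terminal of a state. -/
inductive StateRule (q : Fin m) : NodeArc k m → Prop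
  | toTest : StateRule q (.arc 0 (main []) (test []))
  | toDown (b) : StateRule q (.arc 1 (test []) (down b []))
  | test : StateRule q (.colour Colour.test.idx (Node.test []))
  | toMain (a) : StateRule q (.arc 0 (main []) (main [a]))
  | main (a) : StateRule q (.colour Colour.main.idx (Node.main [a]))
  | letter (a) : StateRule q (.colour (Colour.letter a).idx (Node.main [a]))
  | nonterm (a) : StateRule q (.nonterm (D.step q a).succ (ports [a]))
  | acc (a) (h : D.step q a ∈ D.accept) : StateRule q (.colour Colour.acc.idx (Node.main [a]))
  | downDown (b a) : StateRule q (.arc 1 (down b [a]) (down b []))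
  | downMark (b a) : StateRule q (.arc 1 (down b [a]) (mark b a []))
  | markDown (b a) : StateRule q (.arc 2 (mark b a []) (down b []))
  | mark (b a) : StateRule q (.colour (Colour.mark b a).idx (Node.mark b a []))

theorem mem_accList {q : Fin m} {w : List (Fin k)} {e : NodeArc k m} :
    e ∈ accList D q w ↔ q ∈ D.accept ∧ e = .colour Colour.acc.idx (main w) := by
  unfold accList
  split_ifs with h <;> simp [h]

theorem mem_startRule {e : NodeArc k m} : e ∈ startRule D ↔ StartRule D e := by
  simp only [startRule, List.mem_append, List.mem_cons, List.not_mem_nil, or_false, mem_accList]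
  constructor
  · rintro ((rfl | rfl | rfl | rfl | rfl | rfl | rfl) | ⟨h, rfl⟩) <;> constructor
    exact h
  · rintro (⟨_ | _⟩ | _ | _ | ⟨_ | _⟩ | _ | h) <;> simp [*]

theorem mem_stateRule {q : Fin m} {e : NodeArc k m} : e ∈ stateRule D q ↔ StateRule D q e := by
  simp only [stateRule, letterRule, List.mem_append, List.mem_cons, List.not_mem_nil, or_false,
    mem_accList, List.mem_flatMap, List.mem_finRange, true_and]
  constructor
  · rintro ((rfl | rfl | rfl | rfl) | ⟨a, ((rfl | rfl | rfl | rfl) | ⟨h, rfl⟩) |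
      ⟨b, -, rfl | rfl | rfl | rfl⟩⟩)
    case inr.inl.inr => exact .acc a h
    all_goals constructor
  · rintro (_ | ⟨_ | _⟩ | _ | a | a | a | a | ⟨a, h⟩ | ⟨b, a⟩ | ⟨b, a⟩ | ⟨b, a⟩ | ⟨b, a⟩)
    iterate 4 exact Or.inl (by simp)
    · simp
    all_goals refine Or.inr ⟨a, ?_⟩
    · simp
    · simp
    · simp
    · simp [h]
    all_goals exact Or.inr ⟨b, by cases b <;> simp, by simp⟩

theorem map_code_ports (w : List (Fin k)) :
    ((ports w).map code).length = 3 ∧ (ports w).map code ≠ [] ∧ ((ports w).map code).Nodup := by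
  refine ⟨rfl, by simp [ports], List.Nodup.map code_injective ?_⟩
  simp [ports]

/-- The hypergraph grammar of an automaton. -/
noncomputable abbrev hrGrammar : HRGrammar where
  numNonterm := m + 1
  numLabels := 3
  numColours := Fintype.card (Colour k)
  rank := Fin.cases 0 fun _ => 3
  start := 0
  rank_start := rfl
  -- Nodes in a right-hand side are named relative to the word at hand, which is written `[]`. The
  -- non-terminal 0 is the start symbol, and `q.succ` belongs to the state `q`.
  rhs := Fin.cases ((startRule D).map (Hyperarc.map code)) fun q =>
    (stateRule D q).map (Hyperarc.map code)
  inputs := Fin.cases [] fun _ => (ports []).map (code (k := k))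
  length_inputs A := by
    refine Fin.cases ?_ (fun q => ?_) A
    · rfl
    · exact (map_code_ports []).1
  nodup_inputs A := by
    refine Fin.cases ?_ (fun q => ?_) A
    · exact List.nodup_nil
    · exact (map_code_ports []).2.2
  inputs_mem A := by
    refine Fin.cases ?_ (fun q => ?_) A
    · intro x hx
      simp at hx
    · intro x hx
      simp only [Fin.cases_succ, ports, List.map_cons, List.map_nil, List.mem_cons,
        List.not_mem_nil, or_false] at hx
      rcases hx with rfl | rfl | rfl
      · exact ⟨_, List.mem_map.2 ⟨_, (mem_stateRule D).2 .toTest, rfl⟩,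
          by simp [Hyperarc.map, Hyperarc.verts]⟩
      · exact ⟨_, List.mem_map.2 ⟨_, (mem_stateRule D).2 (.toDown true), rfl⟩,
          by simp [Hyperarc.map, Hyperarc.verts]⟩
      · exact ⟨_, List.mem_map.2 ⟨_, (mem_stateRule D).2 (.toDown false), rfl⟩,
          by simp [Hyperarc.map, Hyperarc.verts]⟩
  rhs_wf A B w := by
    refine Fin.cases ?_ (fun q => ?_) A
    · intro h
      obtain ⟨e, he, h⟩ := List.mem_map.1 h
      rw [mem_startRule] at he
      cases he <;> simp only [Hyperarc.map, Hyperarc.nonterm.injEq, reduceCtorEq] at h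
      obtain ⟨rfl, rfl⟩ := h
      exact map_code_ports _
    · intro h
      obtain ⟨e, he, h⟩ := List.mem_map.1 h
      rw [mem_stateRule] at he
      cases he <;> simp only [Hyperarc.map, Hyperarc.nonterm.injEq, reduceCtorEq] at h
      obtain ⟨rfl, rfl⟩ := h
      exact map_code_ports _

/-! ### The graph of an arbitrary derivation, identified with the graph of nodes. -/

section Derivation

variable {D}
variable (R : (hrGrammar D).Derivation)

/-- The places where non-terminals are rewritten: the start symbol, and one for each word. -/
abbrev Place (k : ℕ) : Type := Option (List (Fin k))

/-- The step in which a place is rewritten. -/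
def level : Place k → ℕ
  | none => 0
  | some w => w.length + 1

variable (D) in
/-- The non-terminal at a place. -/
def symbol : Place k → Fin (m + 1)
  | none => 0
  | some w => (state D w).succ

/-- The vertices of the non-terminal hyperarc of a word. -/
noncomputable def portVertices : List (Fin k) → List ℕ
  | [] => (ports []).map fun x : Node k => R.h 0 0 [] (code x)
  | a :: w => (ports [a]).map fun x : Node k => R.h (w.length + 1) (state D w).succ (portVertices w) (code x)

/-- The vertices of the non-terminal hyperarc at a place. -/
noncomputable def placeVertices : Place k → List ℕ
  | none => []
  | some w => portVertices R w

/-- The copy of a node of a right-hand side that is made at a place. -/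
noncomputable def copy (i : Place k) (x : Node k) : ℕ :=
  R.h (level i) (symbol D i) (placeVertices R i) (code x)

variable (D) in
/-- The right-hand side used at a place. -/
def PlaceRule : Place k → NodeArc k m → Prop
  | none => StartRule D
  | some w => StateRule D (state D w)

theorem mem_ruleGraph {i : Place k} {r} : r ∈ (hrGrammar D).ruleGraph (symbol D i) ↔
    ∃ e, PlaceRule D i e ∧ r = e.map code := by
  cases i with
  | none =>
    change r ∈ (startRule D).map (Hyperarc.map code) ↔ _
    simp only [List.mem_map, mem_startRule, PlaceRule, eq_comm (a := r)]
  | some w =>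
    change r ∈ (stateRule D (state D w)).map (Hyperarc.map code) ↔ _
    simp only [List.mem_map, mem_stateRule, PlaceRule, eq_comm (a := r)]

theorem map_map_code (i : Place k) (e : NodeArc k m) :
    (e.map code).map (R.h (level i) (symbol D i) (placeVertices R i)) = e.map (copy R i) := by
  cases e <;> simp [Hyperarc.map, copy]

/-- The start symbol creates the non-terminal of the empty word, and the non-terminal of `w` creates
those of all `a :: w`, so each step rewrites exactly the places of one level. -/
theorem nonterm_mem_H (n : ℕ) (A u) : Hyperarc.nonterm A u ∈ R.H n ↔
    ∃ i : Place k, level i = n ∧ A = symbol D i ∧ u = placeVertices R i := by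
  induction n generalizing A u with
  | zero =>
    rw [R.H_zero]
    constructor
    · intro h
      simp only [HRGrammar.startGraph, Set.mem_singleton_iff, Hyperarc.nonterm.injEq] at h
      exact ⟨none, rfl, h.1, h.2⟩
    · rintro ⟨_ | w, h, rfl, rfl⟩
      · exact rfl
      · simp [level] at h
  | succ n ih =>
    rw [(R.step n).result]
    constructor
    · rintro (h | ⟨B, v, hB, r, hr, he⟩)
      · exact h.2.elim
      · obtain ⟨i, rfl, rfl, rfl⟩ := (ih _ _).1 hB
        obtain ⟨e, he', rfl⟩ := mem_ruleGraph.1 hr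
        rw [map_map_code] at he
        cases i with
        | none =>
          cases he' <;> simp only [Hyperarc.map, Hyperarc.nonterm.injEq, reduceCtorEq] at he
          obtain ⟨rfl, rfl⟩ := he
          exact ⟨some [], rfl, rfl, rfl⟩
        | some w =>
          cases he' <;> simp only [Hyperarc.map, Hyperarc.nonterm.injEq, reduceCtorEq] at he
          case nonterm a =>
          obtain ⟨rfl, rfl⟩ := he
          exact ⟨some (a :: w), rfl, rfl, rfl⟩
    · rintro ⟨_ | _ | ⟨a, w⟩, h, rfl, rfl⟩
      · simp [level] at h
      · obtain rfl : n = 0 := by simpa [level] using h.symm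
        refine Or.inr ⟨_, _, (ih _ _).2 ⟨none, rfl, rfl, rfl⟩, _,
          mem_ruleGraph.2 ⟨_, StartRule.nonterm, rfl⟩, ?_⟩
        rfl
      · obtain rfl : n = w.length + 1 := by simpa [level] using h.symm
        refine Or.inr ⟨_, _, (ih _ _).2 ⟨some w, rfl, rfl, rfl⟩, _,
          mem_ruleGraph.2 ⟨_, StateRule.nonterm a, rfl⟩, ?_⟩
        rfl

theorem isTerminal_map {N L C V W : Type} (f : V → W) (e : Hyperarc N L C V) :
    (e.map f).IsTerminal ↔ e.IsTerminal := by
  cases e <;> exact Iff.rfl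

theorem terminal_mem_H (n : ℕ) (r) : r ∈ terminalPart (R.H n) ↔
    ∃ i : Place k, level i < n ∧ ∃ e, PlaceRule D i e ∧ e.IsTerminal ∧ r = e.map (copy R i) := by
  induction n with
  | zero =>
    rw [R.H_zero]
    constructor
    · rintro ⟨h, h'⟩
      obtain rfl : r = _ := h
      exact h'.elim
    · rintro ⟨i, hi, -⟩
      exact absurd hi (Nat.not_lt_zero _)
  | succ n ih =>
    have hres : r ∈ terminalPart (R.H (n + 1)) ↔ r ∈ terminalPart (R.H n) ∨
        ∃ i : Place k, level i = n ∧ ∃ e, PlaceRule D i e ∧ e.IsTerminal ∧ r = e.map (copy R i) := by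
      rw [(R.step n).result]
      constructor
      · rintro ⟨h | ⟨B, v, hB, r, hr, rfl⟩, ht⟩
        · exact Or.inl h
        · obtain ⟨i, rfl, rfl, rfl⟩ := (nonterm_mem_H R _ _ _).1 hB
          obtain ⟨e, he', rfl⟩ := mem_ruleGraph.1 hr
          rw [map_map_code] at ht ⊢
          exact Or.inr ⟨i, rfl, e, he', (isTerminal_map _ _).1 ht, rfl⟩
      · rintro (h | ⟨i, rfl, e, he, ht, rfl⟩)
        · exact ⟨Or.inl h, h.2⟩
        · refine ⟨Or.inr ⟨_, _, (nonterm_mem_H R _ _ _).2 ⟨i, rfl, rfl, rfl⟩, _,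
            mem_ruleGraph.2 ⟨e, he, rfl⟩, ?_⟩, (isTerminal_map _ _).2 ht⟩
          exact (map_map_code R i e).symm
    rw [hres, ih]
    constructor
    · rintro (⟨i, hi, h⟩ | ⟨i, hi, h⟩)
      · exact ⟨i, by omega, h⟩
      · exact ⟨i, by omega, h⟩
    · rintro ⟨i, hi, h⟩
      rcases Nat.lt_succ_iff_lt_or_eq.1 hi with hi | hi
      · exact Or.inl ⟨i, hi, h⟩
      · exact Or.inr ⟨i, hi, h⟩

theorem mem_graph (r) : r ∈ R.graph ↔
    ∃ i : Place k, ∃ e, PlaceRule D i e ∧ e.IsTerminal ∧ r = e.map (copy R i) := by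
  rw [HRGrammar.Derivation.graph, Set.mem_iUnion]
  constructor
  · rintro ⟨n, h⟩
    obtain ⟨i, -, h⟩ := (terminal_mem_H R n r).1 h
    exact ⟨i, h⟩
  · rintro ⟨i, h⟩
    exact ⟨level i + 1, (terminal_mem_H R _ r).2 ⟨i, by omega, h⟩⟩

/-- The nodes that are created at a place. -/
inductive IsNew : Place k → Node k → Prop
  | rootMain : IsNew none (main [])
  | rootDown (b) : IsNew none (down b [])
  | main (w a) : IsNew (some w) (main [a])
  | test (w) : IsNew (some w) (test [])
  | down (w b a) : IsNew (some w) (down b [a])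
  | mark (w b a) : IsNew (some w) (mark b a [])

theorem IsNew.exists_terminal {i : Place k} {x : Node k} (h : IsNew i x) :
    ∃ e, PlaceRule D i e ∧ e.IsTerminal ∧ x ∈ e.verts := by
  cases h with
  | rootMain => exact ⟨_, StartRule.main, trivial, by simp [Hyperarc.verts]⟩
  | rootDown b => exact ⟨_, StartRule.loop b, trivial, by simp [Hyperarc.verts]⟩
  | main w a => exact ⟨_, StateRule.main a, trivial, by simp [Hyperarc.verts]⟩
  | test w => exact ⟨_, StateRule.test, trivial, by simp [Hyperarc.verts]⟩
  | down w b a => exact ⟨_, StateRule.downDown b a, trivial, by simp [Hyperarc.verts]⟩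
  | mark w b a => exact ⟨_, StateRule.mark b a, trivial, by simp [Hyperarc.verts]⟩

theorem IsNew.mem_newVertices {i : Place k} {x : Node k} (h : IsNew i x) :
    code x ∈ (hrGrammar D).newVertices (symbol D i) := by
  constructor
  · obtain ⟨e, he, -, hx⟩ := h.exists_terminal (D := D)
    refine ⟨_, mem_ruleGraph.2 ⟨e, he, rfl⟩, ?_⟩
    rw [HRGrammar.mem_verts_map]
    exact List.mem_map_of_mem hx
  · cases i with
    | none => exact List.not_mem_nil
    | some w =>
      change code x ∉ (ports []).map code
      rw [List.mem_map_of_injective code_injective]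
      cases h <;> simp [ports]

theorem copy_mem_vertexSet {i : Place k} {x : Node k} (h : IsNew i x) {n : ℕ} (hn : level i < n) :
    copy R i x ∈ vertexSet (R.H n) := by
  obtain ⟨e, he, ht, hx⟩ := h.exists_terminal (D := D)
  refine ⟨e.map (copy R i), ((terminal_mem_H R n _).2 ⟨i, hn, e, he, ht, rfl⟩).1, ?_⟩
  rw [HRGrammar.mem_verts_map]
  exact List.mem_map_of_mem hx

theorem nonterm_mem_H_level (i : Place k) :
    Hyperarc.nonterm (symbol D i) (placeVertices R i) ∈ R.H (level i) :=
  (nonterm_mem_H R _ _ _).2 ⟨i, rfl, rfl, rfl⟩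

theorem copy_ne_of_placeVertices_ne {i j : Place k} {x y : Node k} (hi : IsNew i x)
    (hj : IsNew j y) (hl : level i = level j) (h : placeVertices R i ≠ placeVertices R j) :
    copy R i x ≠ copy R j y := by
  have h1 := nonterm_mem_H_level R i
  have := (R.step (level i)).disjoint _ _ h1 _ _ (hl ▸ nonterm_mem_H_level R j)
    (fun he => h (Prod.mk.inj he).2) _ hi.mem_newVertices _ hj.mem_newVertices
  intro he
  apply this
  unfold copy at he
  rw [he, hl]

theorem copy_injective_of_isNew {i : Place k} {x y : Node k} (hx : IsNew i x) (hy : IsNew i y)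
    (h : copy R i x = copy R i y) : x = y :=
  code_injective ((R.step (level i)).injOn _ _ (nonterm_mem_H_level R i)
    (hx.mem_newVertices (D := D)).1 (hy.mem_newVertices (D := D)).1 h)

/-- A hypergraph is a set, so two places with the same symbol and vertices would be one hyperarc.
This is excluded by the first port of a nonempty word: it is a new vertex of the place of the
shorter word, and new vertices of distinct hyperarcs differ. -/
theorem portVertices_injective {w w' : List (Fin k)} (hl : w.length = w'.length)
    (h : portVertices R w = portVertices R w') : w = w' := by
  induction w generalizing w' with
  | nil => exact (List.length_eq_zero_iff.1 hl.symm).symm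
  | cons a w ih =>
    cases w' with
    | nil => simp at hl
    | cons a' w' =>
      have hl' : w.length = w'.length := by simpa using hl
      have he : copy R (some w) (main [a]) = copy R (some w') (main [a']) := (List.cons.inj h).1
      have hw : w = w' := by
        by_contra hne
        exact copy_ne_of_placeVertices_ne R (.main w a) (.main w' a') (by simp [level, hl'])
          (fun hp => hne (ih hl' hp)) he
      subst hw
      simpa using copy_injective_of_isNew R (.main w a) (.main w a') he

/-- Each clause of a rewriting step settles one case: `fresh` separates different levels, `disjoint`
different places of one level, and `injOn` different nodes of one place. -/
theorem copy_injective {i j : Place k} {x y : Node k} (hi : IsNew i x) (hj : IsNew j y)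
    (h : copy R i x = copy R j y) : i = j ∧ x = y := by
  have key : ∀ {i j : Place k} {x y : Node k}, IsNew i x → IsNew j y → copy R i x = copy R j y →
      ¬ level i < level j := by
    intro i j x y hi hj h hl
    have := (R.step (level j)).fresh _ _ (nonterm_mem_H_level R j) _ hj.mem_newVertices
    apply this
    change copy R j y ∈ _
    rw [← h]
    exact copy_mem_vertexSet R hi hl
  have hl : level i = level j := by
    have := key hi hj h
    have := key hj hi h.symm
    omega
  have hij : i = j := by
    by_contra hne
    refine copy_ne_of_placeVertices_ne R hi hj hl (fun hp => hne ?_) h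
    cases i with
    | none =>
      cases j with
      | none => rfl
      | some w => simp [level] at hl
    | some w =>
      cases j with
      | none => simp [level] at hl
      | some w' => rw [portVertices_injective R (by simpa [level] using hl) hp]
  subst hij
  exact ⟨rfl, copy_injective_of_isNew R hi hj h⟩

/-- The place where a node is created, and its name in the right-hand side. -/
def birth : Node k → Place k × Node k
  | main [] => (none, main [])
  | main (a :: w) => (some w, main [a])
  | test w => (some w, test [])
  | down b [] => (none, down b [])
  | down b (a :: w) => (some w, down b [a])
  | mark b a w => (some w, mark b a [])

theorem isNew_birth (u : Node k) : IsNew (birth u).1 (birth u).2 := by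
  rcases u with ⟨_ | ⟨a, w⟩⟩ | w | ⟨b, _ | ⟨a, w⟩⟩ | ⟨b, a, w⟩ <;> constructor

theorem birth_injective : Function.Injective (birth (k := k)) := by
  rintro (⟨_ | ⟨a, w⟩⟩ | w | ⟨b, _ | ⟨a, w⟩⟩ | ⟨b, a, w⟩)
    (⟨_ | ⟨a', w'⟩⟩ | w' | ⟨b', _ | ⟨a', w'⟩⟩ | ⟨b', a', w'⟩) h <;> simp_all [birth]

/-- The vertex of the generated graph that represents a node. -/
noncomputable def vertex (u : Node k) : ℕ := copy R (birth u).1 (birth u).2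

theorem vertex_injective : Function.Injective (vertex R) := by
  intro u u' h
  obtain ⟨h1, h2⟩ := copy_injective R (isNew_birth u) (isNew_birth u') h
  exact birth_injective (Prod.ext h1 h2)

theorem map_vertex_ports (w : List (Fin k)) : (ports w).map (vertex R) = portVertices R w := by
  cases w <;> rfl

/-- This is where successive right-hand sides are glued: the inputs at the place `w` become the
vertices of its hyperarc, which were created earlier. -/
theorem map_copy_ports (w : List (Fin k)) :
    (ports []).map (copy R (some w)) = (ports w).map (vertex R) := by
  rw [map_vertex_ports]
  exact (R.step (w.length + 1)).map_inputs _ _ (nonterm_mem_H_level R (some w))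

theorem copy_main_nil (w : List (Fin k)) : copy R (some w) (main []) = vertex R (main w) :=
  (List.cons.inj (map_copy_ports R w)).1

theorem copy_down_nil (w : List (Fin k)) (b : Bool) :
    copy R (some w) (down b []) = vertex R (down b w) := by
  have := (List.cons.inj (map_copy_ports R w)).2
  cases b
  · exact (List.cons.inj (List.cons.inj this).2).1
  · exact (List.cons.inj this).1

theorem arc_mem_graph {l : Fin 3} {x y : ℕ} : .arc l x y ∈ R.graph ↔
    ∃ u : Node k, x = vertex R u ∧ l = u.label ∧ ∃ v ∈ u.succs, y = vertex R v := by
  rw [mem_graph]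
  constructor
  · rintro ⟨i, e, he, -, hr⟩
    cases i with
    | none =>
      cases he <;> simp only [Hyperarc.map, Hyperarc.arc.injEq, reduceCtorEq] at hr
      case loop b =>
        obtain ⟨rfl, rfl, rfl⟩ := hr
        exact ⟨down b [], rfl, rfl, down b [], by simp [succs], rfl⟩
    | some w =>
      cases he <;> simp only [Hyperarc.map, Hyperarc.arc.injEq, reduceCtorEq] at hr <;>
        obtain ⟨rfl, rfl, rfl⟩ := hr
      case toTest => exact ⟨main w, copy_main_nil R w, rfl, test w, by simp [succs], rfl⟩
      case toDown b =>
        exact ⟨test w, rfl, rfl, down b w, by cases b <;> simp [succs], copy_down_nil R w b⟩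
      case toMain a =>
        exact ⟨main w, copy_main_nil R w, rfl, main (a :: w), by simp [succs], rfl⟩
      case downDown b a =>
        exact ⟨down b (a :: w), rfl, rfl, down b w, by simp [succs], copy_down_nil R w b⟩
      case downMark b a =>
        exact ⟨down b (a :: w), rfl, rfl, mark b a w, by simp [succs], rfl⟩
      case markDown b a =>
        exact ⟨mark b a w, rfl, rfl, down b w, by simp [succs], copy_down_nil R w b⟩
  · rintro ⟨u, rfl, rfl, v, hv, rfl⟩
    rcases u with w | w | ⟨b, _ | ⟨a, w⟩⟩ | ⟨b, a, w⟩
    · simp only [succs, List.mem_cons, List.mem_map, List.mem_finRange, true_and] at hv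
      rcases hv with rfl | ⟨a, rfl⟩
      · refine ⟨some w, _, StateRule.toTest, trivial, ?_⟩
        rw [← copy_main_nil]
        rfl
      · refine ⟨some w, _, StateRule.toMain a, trivial, ?_⟩
        rw [← copy_main_nil]
        rfl
    · simp only [succs, List.mem_cons, List.not_mem_nil, or_false] at hv
      rcases hv with rfl | rfl
      · refine ⟨some w, _, StateRule.toDown true, trivial, ?_⟩
        rw [← copy_down_nil]
        rfl
      · refine ⟨some w, _, StateRule.toDown false, trivial, ?_⟩
        rw [← copy_down_nil]
        rfl
    · simp only [succs, List.mem_cons, List.not_mem_nil, or_false] at hv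
      subst hv
      exact ⟨none, _, StartRule.loop b, trivial, rfl⟩
    · simp only [succs, List.mem_cons, List.not_mem_nil, or_false] at hv
      rcases hv with rfl | rfl
      · refine ⟨some w, _, StateRule.downDown b a, trivial, ?_⟩
        rw [← copy_down_nil R w b]
        rfl
      · exact ⟨some w, _, StateRule.downMark b a, trivial, rfl⟩
    · simp only [succs, List.mem_cons, List.not_mem_nil, or_false] at hv
      subst hv
      refine ⟨some w, _, StateRule.markDown b a, trivial, ?_⟩
      rw [← copy_down_nil]
      rfl

variable (D) in
/-- The colours of the nodes. -/
inductive HasColour : Colour k → Node k → Prop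
  | main (w) : HasColour .main (main w)
  | root : HasColour .root (Node.main [])
  | acc (w) (h : state D w ∈ D.accept) : HasColour .acc (Node.main w)
  | letter (a w) : HasColour (.letter a) (Node.main (a :: w))
  | test (w) : HasColour .test (test w)
  | mark (b a w) : HasColour (.mark b a) (mark b a w)
  | halt (b) : HasColour (.halt b) (down b [])

theorem colour_mem_graph {c : Colour k} {u : Node k} :
    .colour c.idx (vertex R u) ∈ R.graph ↔ HasColour D c u := by
  rw [mem_graph]
  constructor
  · rintro ⟨i, e, he, -, hr⟩
    cases i with
    | none =>
      cases he <;> simp only [Hyperarc.map, Hyperarc.colour.injEq, reduceCtorEq] at hr <;>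
        obtain ⟨hc, hu⟩ := hr <;> obtain rfl := Colour.idx_injective hc
      case main => obtain rfl : u = main [] := vertex_injective R hu; exact .main _
      case root => obtain rfl : u = main [] := vertex_injective R hu; exact .root
      case halt b => obtain rfl : u = down b [] := vertex_injective R hu; exact .halt b
      case acc h => obtain rfl : u = main [] := vertex_injective R hu; exact .acc _ h
    | some w =>
      cases he <;> simp only [Hyperarc.map, Hyperarc.colour.injEq, reduceCtorEq] at hr <;>
        obtain ⟨hc, hu⟩ := hr <;> obtain rfl := Colour.idx_injective hc
      case test => obtain rfl : u = test w := vertex_injective R hu; exact .test _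
      case main a => obtain rfl : u = main (a :: w) := vertex_injective R hu; exact .main _
      case letter a => obtain rfl : u = main (a :: w) := vertex_injective R hu; exact .letter _ _
      case acc a h => obtain rfl : u = main (a :: w) := vertex_injective R hu; exact .acc _ h
      case mark b a => obtain rfl : u = mark b a w := vertex_injective R hu; exact .mark _ _ _
  · intro h
    cases h with
    | main w =>
      cases w with
      | nil => exact ⟨none, _, StartRule.main, trivial, rfl⟩
      | cons a w => exact ⟨some w, _, StateRule.main a, trivial, rfl⟩
    | root => exact ⟨none, _, StartRule.root, trivial, rfl⟩
    | acc w h =>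
      cases w with
      | nil => exact ⟨none, _, StartRule.acc h, trivial, rfl⟩
      | cons a w => exact ⟨some w, _, StateRule.acc a h, trivial, rfl⟩
    | letter a w => exact ⟨some w, _, StateRule.letter a, trivial, rfl⟩
    | test w => exact ⟨some w, _, StateRule.test, trivial, rfl⟩
    | mark b a w => exact ⟨some w, _, StateRule.mark b a, trivial, rfl⟩
    | halt b => exact ⟨none, _, StartRule.halt b, trivial, rfl⟩

theorem exists_copy_eq_vertex {i : Place k} {e : NodeArc k m} (he : PlaceRule D i e) {x : Node k}
    (hx : x ∈ e.verts) : ∃ u, copy R i x = vertex R u := by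
  cases i with
  | none =>
    cases he <;> simp only [Hyperarc.verts, ports, List.mem_cons, List.not_mem_nil, or_false,
      or_self] at hx
    case nonterm =>
      rcases hx with rfl | rfl | rfl
      exacts [⟨main [], rfl⟩, ⟨down true [], rfl⟩, ⟨down false [], rfl⟩]
    all_goals subst hx
    case loop b => exact ⟨down b [], rfl⟩
    case halt b => exact ⟨down b [], rfl⟩
    all_goals exact ⟨main [], rfl⟩
  | some w =>
    have hm : ∃ u, copy R (some w) (main []) = vertex R u := ⟨_, copy_main_nil R w⟩
    have hd : ∀ b, ∃ u, copy R (some w) (down b []) = vertex R u := fun b => ⟨_, copy_down_nil R w b⟩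
    have ht : ∃ u, copy R (some w) (test []) = vertex R u := ⟨test w, rfl⟩
    have hm' : ∀ a, ∃ u, copy R (some w) (main [a]) = vertex R u := fun a => ⟨main (a :: w), rfl⟩
    have hd' : ∀ b a, ∃ u, copy R (some w) (down b [a]) = vertex R u :=
      fun b a => ⟨down b (a :: w), rfl⟩
    have hk : ∀ b a, ∃ u, copy R (some w) (mark b a []) = vertex R u := fun b a => ⟨mark b a w, rfl⟩
    cases he <;> simp only [Hyperarc.verts, ports, List.mem_cons, List.not_mem_nil, or_false] at hx
    case nonterm =>
      rcases hx with rfl | rfl | rfl <;> simp only [hm', hd']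
    case test => subst hx; exact ht
    case main => subst hx; exact hm' _
    case letter => subst hx; exact hm' _
    case acc => subst hx; exact hm' _
    case mark => subst hx; exact hk _ _
    all_goals rcases hx with rfl | rfl <;> simp only [hm, hd, ht, hm', hd', hk]

theorem vertexSet_graph : vertexSet R.graph = Set.range (vertex R) := by
  ext v
  constructor
  · rintro ⟨r, hr, hv⟩
    obtain ⟨i, e, he, -, rfl⟩ := (mem_graph R r).1 hr
    rw [HRGrammar.mem_verts_map, List.mem_map] at hv
    obtain ⟨x, hx, rfl⟩ := hv
    obtain ⟨u, hu⟩ := exists_copy_eq_vertex R he hx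
    exact ⟨u, hu.symm⟩
  · rintro ⟨u, rfl⟩
    obtain ⟨e, he, ht, hx⟩ := (isNew_birth u).exists_terminal (D := D)
    refine ⟨e.map (copy R (birth u).1), (mem_graph R _).2 ⟨_, e, he, ht, rfl⟩, ?_⟩
    rw [HRGrammar.mem_verts_map]
    exact List.mem_map_of_mem hx

theorem targets_graph (u : Node k) (l : Fin 3) : targets R.graph (vertex R u) l =
    if l = u.label then vertex R '' {v | v ∈ u.succs} else ∅ := by
  ext y
  change .arc l (vertex R u) y ∈ R.graph ↔ _
  rw [arc_mem_graph]
  constructor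
  · rintro ⟨u', hu, rfl, v, hv, rfl⟩
    obtain rfl := vertex_injective R hu
    rw [if_pos rfl]
    exact ⟨v, hv, rfl⟩
  · intro h
    split_ifs at h with hl
    · obtain ⟨v, hv, rfl⟩ := h
      exact ⟨u, rfl, hl, v, hv, rfl⟩
    · exact h.elim

end Derivation

/-- The probabilistic hypergraph grammar of an automaton. -/
noncomputable def grammar : PHRGrammar where
  toHRGrammar := hrGrammar D
  μ l := ⟨weight k l, weight_mem k l⟩
  finite_targets v hv l := by
    obtain ⟨u, rfl⟩ := (vertexSet_graph (hrGrammar D).derivation ▸ hv :)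
    rw [HRGrammar.graph, targets_graph]
    split_ifs
    · exact (List.finite_toSet _).image _
    · exact Set.finite_empty
  sum_eq_one v hv := by
    obtain ⟨u, rfl⟩ := (vertexSet_graph (hrGrammar D).derivation ▸ hv :)
    rw [Finset.sum_eq_single u.label]
    · rw [HRGrammar.graph, targets_graph, if_pos rfl,
        Set.ncard_image_of_injective _ (vertex_injective _)]
      have : {v | v ∈ u.succs}.ncard = u.succs.length := by
        classical
        rw [← List.coe_toFinset, Set.ncard_coe_finset, List.toFinset_card_of_nodup u.nodup_succs]
      rw [this]
      exact u.weight_mul_length_succs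
    · intro l _ hl
      rw [HRGrammar.graph, targets_graph, if_neg hl]
      simp
    · simp

end Automaton

namespace Automaton

open Node

variable {k m : ℕ} (D : DFA (Fin k) (Fin m))

/-! ## The Markov chain of the grammar of an automaton -/

/-- The Markov chain of the grammar of an automaton. -/
noncomputable abbrev nodeChain :
    LabelledMarkovChain (grammar D).Vertex (Fin (Fintype.card (Colour k))) := (grammar D).chain

/-- The state of the Markov chain that represents a node. -/
noncomputable def point (u : Node k) : (grammar D).Vertex :=
  ⟨vertex (hrGrammar D).derivation u, by
    change _ ∈ vertexSet (hrGrammar D).derivation.graph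
    rw [vertexSet_graph]
    exact ⟨u, rfl⟩⟩

theorem point_bijective : Function.Bijective (point D) := by
  constructor
  · intro u v h
    exact vertex_injective _ (congrArg Subtype.val h)
  · rintro ⟨v, hv⟩
    obtain ⟨u, rfl⟩ := (vertexSet_graph (hrGrammar D).derivation ▸ hv :)
    exact ⟨u, rfl⟩

/-- The probability of the arcs that leave a node. -/
noncomputable def arcProb (u : Node k) : ℝ≥0∞ := ENNReal.ofReal ((weight k u.label : ℚ) : ℝ)

theorem weight_pos (u : Node k) : 0 < weight k u.label := by
  have h := u.weight_mul_length_succs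
  have h' := (weight_mem k u.label).1
  rcases h'.lt_or_eq with h' | h'
  · exact h'
  · rw [← h'] at h
    simp at h

open Classical in
-- All arcs that leave a node carry the same label, so at most one term of the sum over labels is
-- nonzero.
theorem step_point (u v : Node k) :
    (nodeChain D).step (point D u) (point D v) = if v ∈ u.succs then arcProb u else 0 := by
  change (grammar D).transProb (vertex _ u) (vertex _ v) = _
  unfold PHRGrammar.transProb
  have ht : ∀ l : Fin 3, vertex (hrGrammar D).derivation v ∈
      targets (grammar D).graph (vertex (hrGrammar D).derivation u) l ↔
        l = u.label ∧ v ∈ u.succs := by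
    intro l
    change _ ∈ targets (hrGrammar D).derivation.graph _ _ ↔ _
    rw [targets_graph]
    split_ifs with h
    · rw [(vertex_injective _).mem_set_image]
      simp [h]
    · simp [h]
  refine (Finset.sum_eq_single (ι := Fin 3) u.label ?_ ?_).trans ?_
  · intro l _ hl
    refine if_neg ?_
    rw [ht]
    exact fun h => hl h.1
  · intro h
    exact absurd (Finset.mem_univ _) h
  · refine if_congr ((ht _).trans ?_) rfl rfl
    simp

theorem tsum_step_point (u : Node k) (f : (grammar D).Vertex → ℝ≥0∞) :
    ∑' t, (nodeChain D).step (point D u) t * f t =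
      arcProb u * (u.succs.map fun v => f (point D v)).sum := by
  classical
  rw [← (Equiv.ofBijective _ (point_bijective D)).tsum_eq]
  simp only [Equiv.ofBijective_apply, step_point]
  rw [tsum_eq_sum (s := u.succs.toFinset)
    (fun v hv => by rw [if_neg (by simpa using hv), zero_mul]),
    Finset.sum_congr rfl (g := fun v => arcProb u * f (point D v))
      (fun v hv => by rw [if_pos (by simpa using hv)]),
    ← Finset.mul_sum, List.sum_toFinset _ u.nodup_succs]

theorem mem_label_point (c : Colour k) (u : Node k) :
    c.idx ∈ (nodeChain D).label (point D u) ↔ HasColour D c u :=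
  colour_mem_graph (hrGrammar D).derivation

theorem nextPaths_pos_iff {u : Node k} {A : Set (grammar D).Vertex} :
    ((nodeChain D).pathMeasure (point D u)).real (nextPaths A) > 0 ↔
      ∃ v ∈ u.succs, point D v ∈ A := by
  classical
  have h0 : arcProb u ≠ 0 := by
    have := weight_pos u
    simpa [arcProb] using this
  rw [gt_iff_lt, measureReal_def, ENNReal.toReal_pos_iff, and_iff_left (measure_lt_top _ _),
    LabelledMarkovChain.pathMeasure_nextPaths, tsum_step_point, pos_iff_ne_zero]
  simp only [ne_eq, mul_eq_zero, h0, false_or, List.sum_eq_zero_iff, List.mem_map,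
    forall_exists_index, and_imp, forall_apply_eq_imp_iff₂, not_forall]
  constructor
  · rintro ⟨v, hv, h⟩
    exact ⟨v, hv, by
      by_contra hn
      exact h (Set.indicator_of_notMem hn _)⟩
  · rintro ⟨v, hv, h⟩
    exact ⟨v, hv, by rw [Set.indicator_of_mem h]; simp⟩

/-- The probability to reach `B` through `A` from a node. -/
noncomputable def untilProb (A B : Set (grammar D).Vertex) (u : Node k) : ℝ :=
  ((nodeChain D).pathMeasure (point D u)).real (untilPaths A B)

variable {D}

theorem untilProb_of_mem {A B : Set (grammar D).Vertex} {u : Node k} (h : point D u ∈ B) :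
    untilProb D A B u = 1 := by
  rw [untilProb, measureReal_def, LabelledMarkovChain.pathMeasure_untilPaths_of_mem _ h,
    ENNReal.toReal_one]

theorem untilProb_of_notMem {A B : Set (grammar D).Vertex} {u : Node k} (hA : point D u ∉ A)
    (hB : point D u ∉ B) : untilProb D A B u = 0 := by
  rw [untilProb, measureReal_def, LabelledMarkovChain.pathMeasure_untilPaths_of_notMem _ hA hB,
    ENNReal.toReal_zero]

theorem untilProb_step {A B : Set (grammar D).Vertex} {u : Node k} (hA : point D u ∈ A)
    (hB : point D u ∉ B) : untilProb D A B u =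
      ((weight k u.label : ℚ) : ℝ) * (u.succs.map (untilProb D A B)).sum := by
  have hw : (0 : ℝ) ≤ ((weight k u.label : ℚ) : ℝ) := by exact_mod_cast (weight_pos u).le
  have hs : ∀ l : List (Node k), ((l.map fun v =>
      (nodeChain D).pathMeasure (point D v) (untilPaths A B)).sum).toReal =
      (l.map (untilProb D A B)).sum := by
    intro l
    induction l with
    | nil => simp
    | cons v l ih =>
      have hl : (l.map fun v => (nodeChain D).pathMeasure (point D v) (untilPaths A B)).sum ≠ ⊤ := by
        clear ih
        induction l with
        | nil => simp
        | cons v l ih =>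
          rw [List.map_cons, List.sum_cons]
          exact ENNReal.add_ne_top.2 ⟨measure_ne_top _ _, ih⟩
      rw [List.map_cons, List.map_cons, List.sum_cons, List.sum_cons,
        ENNReal.toReal_add (measure_ne_top _ _) hl, ih]
      rfl
  rw [untilProb, measureReal_def, LabelledMarkovChain.pathMeasure_untilPaths_step _ hA hB,
    tsum_step_point, ENNReal.toReal_mul, arcProb, ENNReal.toReal_ofReal hw, hs]

theorem untilProb_test {A B : Set (grammar D).Vertex} {w : List (Fin k)}
    (hA : point D (test w) ∈ A) (hB : point D (test w) ∉ B) : untilProb D A B (test w) =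
      1 / 2 * (untilProb D A B (down true w) + untilProb D A B (down false w)) := by
  rw [untilProb_step hA hB]
  simp [label, succs, weight]

theorem untilProb_down_cons {A B : Set (grammar D).Vertex} {b : Bool} {a : Fin k} {w : List (Fin k)}
    (hA : point D (down b (a :: w)) ∈ A) (hB : point D (down b (a :: w)) ∉ B) :
    untilProb D A B (down b (a :: w)) =
      1 / 2 * (untilProb D A B (down b w) + untilProb D A B (mark b a w)) := by
  rw [untilProb_step hA hB]
  simp [label, succs, weight]

theorem untilProb_mark {A B : Set (grammar D).Vertex} {b : Bool} {a : Fin k} {w : List (Fin k)}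
    (hA : point D (mark b a w) ∈ A) (hB : point D (mark b a w) ∉ B) :
    untilProb D A B (mark b a w) = untilProb D A B (down b w) := by
  rw [untilProb_step hA hB]
  simp [label, succs, weight]

variable (D)

/-! ## Formulae -/

/-- Formulae over the colours. -/
abbrev Formula (k : ℕ) : Type := PCTL (Fin (Fintype.card (Colour k)))

/-- The nodes that satisfy a formula. -/
def Sat (φ : Formula k) (u : Node k) : Prop := point D u ∈ (nodeChain D).sat φ

/-- Colours as formulae. -/
noncomputable def colourF (c : Colour k) : Formula k := .atom c.idx

/-- Conjunctions of lists of formulae. -/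
def conjList : List (Formula k) → Formula k
  | [] => .tt
  | φ :: l => .conj φ (conjList l)

variable {D}

theorem sat_colourF {c : Colour k} {u : Node k} : Sat D (colourF c) u ↔ HasColour D c u :=
  mem_label_point D c u

theorem sat_neg {φ : Formula k} {u : Node k} : Sat D (.neg φ) u ↔ ¬ Sat D φ u := Iff.rfl

theorem sat_conj {φ ψ : Formula k} {u : Node k} : Sat D (.conj φ ψ) u ↔ Sat D φ u ∧ Sat D ψ u :=
  Iff.rfl

theorem sat_conjList {l : List (Formula k)} {u : Node k} :
    Sat D (conjList l) u ↔ ∀ φ ∈ l, Sat D φ u := by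
  induction l with
  | nil => exact ⟨fun _ φ h => by simp at h, fun _ => trivial⟩
  | cons φ l ih => rw [conjList, sat_conj, ih, List.forall_mem_cons]

/-- The formula that holds where none of the given colours is present. -/
noncomputable def noneOf (l : List (Colour k)) : Formula k := conjList (l.map fun c => .neg (colourF c))

theorem sat_noneOf {l : List (Colour k)} {u : Node k} :
    Sat D (noneOf l) u ↔ ∀ c ∈ l, ¬ HasColour D c u := by
  simp only [noneOf, sat_conjList, List.forall_mem_map, sat_neg, sat_colourF]

/-- The states to be traversed in a comparison: no upper mark of a letter in `I`, and no lower
end of a branch. -/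
noncomputable def stayF (I : List (Fin k)) : Formula k :=
  noneOf (.halt false :: I.map (.mark true))

/-- The states to be reached in a comparison: the end of an upper branch, or a lower mark of a letter in `J`. -/
noncomputable def goalF (J : List (Fin k)) : Formula k :=
  .neg (noneOf (.halt true :: J.map (.mark false)))

theorem sat_stayF {I : List (Fin k)} {u : Node k} : Sat D (stayF I) u ↔
    ¬ HasColour D (.halt false) u ∧ ∀ a ∈ I, ¬ HasColour D (.mark true a) u := by
  simp only [stayF, sat_noneOf, List.forall_mem_cons, List.forall_mem_map]

theorem sat_goalF {J : List (Fin k)} {u : Node k} : Sat D (goalF J) u ↔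
    HasColour D (.halt true) u ∨ ∃ a ∈ J, HasColour D (.mark false a) u := by
  simp only [goalF, sat_neg, sat_noneOf, List.forall_mem_cons, List.forall_mem_map, not_and_or,
    not_not, not_forall, exists_prop]

/-- The probability computed by a comparison. -/
noncomputable def compareProb (D : DFA (Fin k) (Fin m)) (I J : List (Fin k)) (u : Node k) : ℝ :=
  untilProb D ((nodeChain D).sat (stayF I)) ((nodeChain D).sat (goalF J)) u

/-- A letter outside `I` is harmless, since the direct arc and the detour both lead to the next node
of the branch. A letter in `I` makes the detour fail and halves the probability. -/
theorem compareProb_down_true (I J : List (Fin k)) (w : List (Fin k)) :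
    compareProb D I J (down true w) = (1 / 2) ^ (w.countP (· ∈ I)) := by
  induction w with
  | nil =>
    rw [compareProb, untilProb_of_mem (sat_goalF.2 (Or.inl (.halt true)))]
    simp
  | cons a w ih =>
    have h1 : compareProb D I J (down true (a :: w)) = 1 / 2 *
        (compareProb D I J (down true w) + compareProb D I J (mark true a w)) := by
      refine untilProb_down_cons (sat_stayF.2 ⟨?_, fun c _ => ?_⟩)
        (mt sat_goalF.1 (not_or.2 ⟨?_, ?_⟩))
      · rintro ⟨⟩
      · rintro ⟨⟩
      · rintro ⟨⟩
      · rintro ⟨c, _, ⟨⟩⟩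
    have hB : ¬ Sat D (goalF J) (mark true a w) := by
      refine mt sat_goalF.1 (not_or.2 ⟨?_, ?_⟩)
      · rintro ⟨⟩
      · rintro ⟨c, _, ⟨⟩⟩
    by_cases ha : a ∈ I
    · have h2 : compareProb D I J (mark true a w) = 0 :=
        untilProb_of_notMem (fun h => (sat_stayF.1 h).2 a ha (.mark _ _ _)) hB
      rw [h1, h2, ih, List.countP_cons_of_pos (by simpa using ha), pow_succ]
      ring
    · have h2 : compareProb D I J (mark true a w) = compareProb D I J (down true w) := by
        refine untilProb_mark (sat_stayF.2 ⟨?_, fun c hc => ?_⟩) hB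
        · rintro ⟨⟩
        · rintro ⟨⟩
          exact ha hc
      rw [h1, h2, ih, List.countP_cons_of_neg (by simpa using ha)]
      ring

/-- Dual to the upper branch: a detour through a letter in `J` succeeds at once and the lower end
fails, so each letter in `J` halves the probability of failure. -/
theorem compareProb_down_false (I J : List (Fin k)) (w : List (Fin k)) :
    compareProb D I J (down false w) = 1 - (1 / 2) ^ (w.countP (· ∈ J)) := by
  induction w with
  | nil =>
    rw [compareProb, untilProb_of_notMem (fun h => (sat_stayF.1 h).1 (.halt _))
      (mt sat_goalF.1 (not_or.2 ⟨?_, ?_⟩))]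
    · simp
    · rintro ⟨⟩
    · rintro ⟨c, _, ⟨⟩⟩
  | cons a w ih =>
    have h1 : compareProb D I J (down false (a :: w)) = 1 / 2 *
        (compareProb D I J (down false w) + compareProb D I J (mark false a w)) := by
      refine untilProb_down_cons (sat_stayF.2 ⟨?_, fun c _ => ?_⟩)
        (mt sat_goalF.1 (not_or.2 ⟨?_, ?_⟩))
      · rintro ⟨⟩
      · rintro ⟨⟩
      · rintro ⟨⟩
      · rintro ⟨c, _, ⟨⟩⟩
    by_cases ha : a ∈ J
    · have h2 : compareProb D I J (mark false a w) = 1 :=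
        untilProb_of_mem (sat_goalF.2 (Or.inr ⟨a, ha, .mark _ _ _⟩))
      rw [h1, h2, ih, List.countP_cons_of_pos (by simpa using ha), pow_succ]
      ring
    · have h2 : compareProb D I J (mark false a w) = compareProb D I J (down false w) := by
        refine untilProb_mark (sat_stayF.2 ⟨?_, fun c hc => ?_⟩)
          (mt sat_goalF.1 (not_or.2 ⟨?_, ?_⟩))
        · rintro ⟨⟩
        · rintro ⟨⟩
        · rintro ⟨⟩
        · rintro ⟨c, hc, ⟨⟩⟩
          exact ha hc
      rw [h1, h2, ih, List.countP_cons_of_neg (by simpa using ha)]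
      ring

theorem compareProb_test (I J : List (Fin k)) (w : List (Fin k)) :
    compareProb D I J (test w) =
      1 / 2 * ((1 / 2) ^ (w.countP (· ∈ I)) + (1 - (1 / 2) ^ (w.countP (· ∈ J)))) := by
  rw [← compareProb_down_true (D := D) I J, ← compareProb_down_false (D := D) I J]
  refine untilProb_test (sat_stayF.2 ⟨?_, fun c _ => ?_⟩) (mt sat_goalF.1 (not_or.2 ⟨?_, ?_⟩))
  · rintro ⟨⟩
  · rintro ⟨⟩
  · rintro ⟨⟩
  · rintro ⟨c, _, ⟨⟩⟩

/-- The threshold zero. -/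
def zeroProb : RatProb := ⟨0, by norm_num, by norm_num⟩

/-- The threshold `1 / 2 ^ (n + 1)`. -/
def halfPow (n : ℕ) : RatProb :=
  ⟨((2 ^ (n + 1) : ℕ) : ℚ)⁻¹, by positivity, inv_le_one_of_one_le₀ (by
    exact_mod_cast Nat.one_le_two_pow)⟩

theorem coe_halfPow (n : ℕ) : (((halfPow n : RatProb) : ℚ) : ℝ) = (1 / 2) ^ (n + 1) := by
  simp [halfPow]

/-- The formula that holds at a main node if its test node yields the probability `ρ` in a
comparison. -/
noncomputable def compareF (ρ : RatProb) (I J : List (Fin k)) : Formula k :=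
  .next .gt zeroProb (.conj (colourF .test)
    (.conj (.untl .ge ρ (stayF I) (goalF J)) (.untl .le ρ (stayF I) (goalF J))))

/-- Exactly one successor of a main node has the colour `test`, so the next operator with threshold
`> 0` evaluates the inner formula there; the two until formulae together say that the probability is
exactly `ρ`. -/
theorem sat_compareF {ρ : RatProb} {I J w : List (Fin k)} : Sat D (compareF ρ I J) (main w) ↔
    1 / 2 * ((1 / 2) ^ (w.countP (· ∈ I)) + (1 - (1 / 2) ^ (w.countP (· ∈ J)))) =
      (((ρ : RatProb) : ℚ) : ℝ) := by
  have h1 : Sat D (compareF ρ I J) (main w) ↔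
      ((nodeChain D).pathMeasure (point D (main w))).real (nextPaths
        ((nodeChain D).sat (.conj (colourF .test) (.conj (.untl .ge ρ (stayF I) (goalF J))
          (.untl .le ρ (stayF I) (goalF J)))))) > ((zeroProb : ℚ) : ℝ) := Iff.rfl
  rw [h1, show ((zeroProb : ℚ) : ℝ) = 0 by simp [zeroProb], nextPaths_pos_iff,
    ← compareProb_test (D := D)]
  constructor
  · rintro ⟨v, hv, ht, hge, hle⟩
    simp only [succs, List.mem_cons, List.mem_map, List.mem_finRange, true_and] at hv
    rcases hv with rfl | ⟨a, rfl⟩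
    · exact le_antisymm hle hge
    · cases sat_colourF.1 ht
  · intro h
    exact ⟨test w, by simp [succs], sat_colourF.2 (.test w), h.ge, h.le⟩

theorem sat_compareF_half {I J w : List (Fin k)} : Sat D (compareF (halfPow 0) I J) (main w) ↔
    w.countP (· ∈ I) = w.countP (· ∈ J) := by
  rw [sat_compareF, coe_halfPow]
  constructor
  · intro h
    have : ((1 : ℝ) / 2) ^ (w.countP (· ∈ I)) = (1 / 2) ^ (w.countP (· ∈ J)) := by linarith
    exact pow_right_injective₀ (by norm_num) (by norm_num) this
  · intro h
    rw [h]
    ring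

/-- With `J` empty the lower branch contributes nothing, and the entry into the upper branch
accounts for the extra factor 1/2 in `halfPow n`. -/
theorem sat_compareF_nil {n : ℕ} {I w : List (Fin k)} :
    Sat D (compareF (halfPow n) I []) (main w) ↔ w.countP (· ∈ I) = n := by
  rw [sat_compareF, coe_halfPow]
  have : w.countP (fun a => decide (a ∈ ([] : List (Fin k)))) = 0 := by simp
  rw [this]
  constructor
  · intro h
    have : ((1 : ℝ) / 2) ^ (w.countP (· ∈ I)) = (1 / 2) ^ n := by
      rw [pow_succ] at h
      linarith
    exact pow_right_injective₀ (by norm_num) (by norm_num) this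
  · intro h
    rw [h]
    ring

/-! ## Simulation of counter programs -/

/-- The counters after a word. -/
def counters (op : Fin k → Op) : List (Fin k) → Counters
  | [] => fun _ => 0
  | a :: w => (op a).act (counters op w)

/-- All the tests in a word are passed. -/
def Passes (op : Fin k → Op) : List (Fin k) → Prop
  | [] => True
  | a :: w => (op a).Enabled (counters op w) ∧ Passes op w

theorem exec_map_iff (op : Fin k → Op) (w : List (Fin k)) (s : Counters) :
    Op.Exec (w.map op) (fun _ => 0) s ↔ Passes op w.reverse ∧ s = counters op w.reverse := by
  induction w using List.reverseRecOn generalizing s with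
  | nil => simp [Op.Exec, Passes, counters]
  | append_singleton w a ih =>
    rw [List.map_append, Op.exec_append, List.reverse_append]
    simp only [ih, List.map_cons, List.map_nil, Op.Exec, List.reverse_cons, List.reverse_nil,
      List.nil_append, List.cons_append, Passes, counters]
    constructor
    · rintro ⟨t, ⟨h1, rfl⟩, h2, rfl⟩
      exact ⟨⟨h2, h1⟩, rfl⟩
    · rintro ⟨⟨h2, h1⟩, rfl⟩
      exact ⟨_, ⟨h1, rfl⟩, h2, rfl⟩

/-- The instruction increments the counter `r`. -/
def _root_.ProbHypergraph.Op.IsInc (r : ℕ) (o : Op) : Prop := o = .inc r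

/-- The instruction decrements the counter `r`. -/
def _root_.ProbHypergraph.Op.IsDec (r : ℕ) (o : Op) : Prop := ∃ r', o = .dec r' ∧ r' + 1 = r

open Classical in
/-- The letters whose instruction has some property. -/
noncomputable def letters (op : Fin k → Op) (p : Op → Prop) : List (Fin k) :=
  (List.finRange k).filter fun a => p (op a)

theorem mem_letters {op : Fin k → Op} {p : Op → Prop} {a : Fin k} :
    a ∈ letters op p ↔ p (op a) := by
  simp [letters]

theorem countP_letters_cons (op : Fin k → Op) (p : Op → Prop) [DecidablePred p] (a : Fin k)
    (w : List (Fin k)) : (a :: w).countP (· ∈ letters op p) =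
      w.countP (· ∈ letters op p) + if p (op a) then 1 else 0 := by
  rw [List.countP_cons]
  simp [mem_letters]

theorem countP_letters_zero (op : Fin k → Op) (r : ℕ) (w : List (Fin k)) :
    (w.countP (· ∈ letters op (Op.IsInc r)) : ℤ) - w.countP (· ∈ letters op (Op.IsDec r)) =
      counters op w r := by
  classical
  induction w with
  | nil => simp [counters]
  | cons a w ih =>
    rw [countP_letters_cons, countP_letters_cons, counters]
    push_cast
    cases op a with
    | inc r' =>
      by_cases h : r' = r
      · subst h
        simp [Op.IsInc, Op.IsDec, Op.act]
        omega
      · simp [Op.IsInc, Op.IsDec, Op.act, h, Function.update_of_ne (Ne.symm h), ih]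
    | dec r' =>
      by_cases h : r' + 1 = r
      · subst h
        simp [Op.IsInc, Op.IsDec, Op.act]
        omega
      · simp [Op.IsInc, Op.IsDec, Op.act, h, Function.update_of_ne (Ne.symm h), ih]
    | eq i j => simpa [Op.IsInc, Op.IsDec, Op.act] using ih
    | zero r' => simpa [Op.IsInc, Op.IsDec, Op.act] using ih

/-- No instruction is both an increment and a decrement, so the counts add up. -/
theorem countP_letters_or (op : Fin k → Op) (i j : ℕ) (w : List (Fin k)) :
    w.countP (· ∈ letters op fun o => o.IsInc i ∨ o.IsDec j) =
      w.countP (· ∈ letters op (Op.IsInc i)) + w.countP (· ∈ letters op (Op.IsDec j)) := by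
  classical
  induction w with
  | nil => simp
  | cons a w ih =>
    rw [countP_letters_cons, countP_letters_cons, countP_letters_cons, ih]
    cases op a <;> simp [Op.IsInc, Op.IsDec] <;> omega

/-- The test of an instruction, as a formula that holds after its execution. -/
noncomputable def enabledF (op : Fin k → Op) : Op → Formula k
  | .inc _ => .tt
  | .dec _ => .tt
  | .eq i j => compareF (halfPow 0) (letters op fun o => o.IsInc i ∨ o.IsDec j)
      (letters op fun o => o.IsInc j ∨ o.IsDec i)
  | .zero r => compareF (halfPow 0) (letters op (Op.IsInc r)) (letters op (Op.IsDec r))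

/-- Instructions with a nontrivial test leave the counters unchanged, so the test may be evaluated
after the instruction. Equality of two differences of counts is compared in the form of equality of
two sums. -/
theorem sat_enabledF {op : Fin k → Op} {a : Fin k} {w : List (Fin k)} :
    Sat D (enabledF op (op a)) (main (a :: w)) ↔ (op a).Enabled (counters op w) := by
  have hc : counters op (a :: w) = (op a).act (counters op w) := rfl
  have hz := fun r => countP_letters_zero op r (a :: w)
  rw [hc] at hz
  generalize op a = o at hz
  cases o with
  | inc r => exact iff_of_true trivial trivial
  | dec r => exact iff_of_true trivial trivial
  | eq i j =>
    rw [enabledF, sat_compareF_half, countP_letters_or, countP_letters_or]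
    have h1 := hz i
    have h2 := hz j
    simp only [Op.act, Op.Enabled] at h1 h2 ⊢
    omega
  | zero r =>
    rw [enabledF, sat_compareF_half]
    have h1 := hz r
    simp only [Op.act, Op.Enabled] at h1 ⊢
    omega

/-- The formula that holds at a main node if the last instruction has passed its test. -/
noncomputable def okF (op : Fin k → Op) : Formula k :=
  .conj (colourF .main) (conjList ((List.finRange k).map fun a =>
    .neg (.conj (colourF (.letter a)) (.neg (enabledF op (op a))))))

theorem sat_okF {op : Fin k → Op} {u : Node k} : Sat D (okF op) u ↔
    ∃ w, u = main w ∧ ∀ a w', w = a :: w' → (op a).Enabled (counters op w') := by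
  simp only [okF, sat_conj, sat_colourF, sat_conjList, List.forall_mem_map, List.mem_finRange,
    true_imp_iff, sat_neg, not_and, not_not]
  constructor
  · rintro ⟨⟨w⟩, h⟩
    refine ⟨w, rfl, ?_⟩
    rintro a w' rfl
    exact sat_enabledF.1 (h a (.letter a w'))
  · rintro ⟨w, rfl, h⟩
    refine ⟨.main w, ?_⟩
    rintro a ⟨⟩
    exact sat_enabledF.2 (h a _ rfl)

/-- The formula that holds at a node that is reached by an accepting run on the input `n`, provided
that all earlier tests are passed. -/
noncomputable def acceptF (op : Fin k → Op) (n : ℕ) : Formula k :=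
  .conj (okF op) (.conj (colourF .acc) (compareF (halfPow n) (letters op (Op.IsInc 0)) []))

/-- Since the counter 0 is never decremented, its content is a single letter count, which can be
compared with a constant. -/
theorem countP_letters_inc_zero (op : Fin k → Op) (w : List (Fin k)) :
    (w.countP (· ∈ letters op (Op.IsInc 0)) : ℤ) = counters op w 0 := by
  rw [← countP_letters_zero]
  have : w.countP (· ∈ letters op (Op.IsDec 0)) = 0 := by
    rw [List.countP_eq_zero]
    intro a _
    simp [mem_letters, Op.IsDec]
  rw [this]
  simp

theorem sat_acceptF {op : Fin k → Op} {n : ℕ} {u : Node k} : Sat D (acceptF op n) u ↔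
    Sat D (okF op) u ∧ ∃ w, u = main w ∧ state D w ∈ D.accept ∧ counters op w 0 = n := by
  simp only [acceptF, sat_conj, sat_colourF]
  refine and_congr_right fun _ => ?_
  constructor
  · rintro ⟨h, hn⟩
    cases h with | acc w h =>
    rw [sat_compareF_nil] at hn
    exact ⟨w, rfl, h, by rw [← countP_letters_inc_zero, hn]⟩
  · rintro ⟨w, rfl, h, hn⟩
    refine ⟨.acc w h, sat_compareF_nil.2 ?_⟩
    rw [← countP_letters_inc_zero] at hn
    exact_mod_cast hn

/-- The formula that holds at the root if the input `n` is accepted, and nowhere else. -/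
noncomputable def haltF (op : Fin k → Op) (n : ℕ) : Formula k :=
  .conj (colourF .root) (.untl .gt zeroProb (okF op) (acceptF op n))

/-- The input `n` is accepted. -/
def Accepts (D : DFA (Fin k) (Fin m)) (op : Fin k → Op) (n : ℕ) : Prop :=
  ∃ w, Passes op w ∧ state D w ∈ D.accept ∧ counters op w 0 = n

/-- `okF` confines paths to main nodes, where a step appends one letter. Each node tests only its
last instruction, but a path from the root visits all prefixes of its final word. -/
theorem canReach_iff {op : Fin k → Op} {n : ℕ} :
    (nodeChain D).CanReach ((nodeChain D).sat (okF op)) ((nodeChain D).sat (acceptF op n))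
      (point D (main [])) ↔ Accepts D op n := by
  classical
  constructor
  · have hok : ∀ s, (nodeChain D).CanReach ((nodeChain D).sat (okF op))
        ((nodeChain D).sat (acceptF op n)) s → s ∈ (nodeChain D).sat (okF op) := by
      rintro s (h | ⟨h, -, -⟩)
      · exact h.1
      · exact h
    -- The invariant along a path is that the tests of `w.tail` are passed; `okF` adds the test of
    -- the head.
    have hpass : ∀ w, Sat D (okF op) (main w) → Passes op w.tail → Passes op w := by
      intro w h hw
      obtain ⟨w', he, h⟩ := sat_okF.1 h
      obtain rfl : w = w' := by simpa using he
      cases w with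
      | nil => trivial
      | cons a w => exact ⟨h a w rfl, hw⟩
    have key : ∀ s, (nodeChain D).CanReach ((nodeChain D).sat (okF op))
        ((nodeChain D).sat (acceptF op n)) s → ∀ w, s = point D (main w) → Passes op w.tail →
        Accepts D op n := by
      intro s hs
      induction hs with
      | base h =>
        rintro w rfl hw
        obtain ⟨h1, w', he, h2, h3⟩ := sat_acceptF.1 h
        obtain rfl : w = w' := by simpa using he
        exact ⟨w, hpass w h1 hw, h2, h3⟩
      | @step s t h hst ht ih =>
        rintro w rfl hw
        obtain ⟨v, rfl⟩ := (point_bijective D).2 t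
        rw [step_point] at hst
        have hv : v ∈ (main w).succs := by
          by_contra hv
          exact hst (if_neg hv)
        obtain ⟨w', rfl, -⟩ := sat_okF.1 (hok _ ht)
        simp only [succs, List.mem_cons, List.mem_map, List.mem_finRange, true_and, reduceCtorEq,
          main.injEq, false_or] at hv
        obtain ⟨a, rfl⟩ := hv
        exact ih _ rfl (hpass w h hw)
    intro h
    exact key _ h [] rfl trivial
  · rintro ⟨w, hw, hacc, hn⟩
    have hok : ∀ w, Passes op w → Sat D (okF op) (main w) := by
      intro w hw
      refine sat_okF.2 ⟨w, rfl, ?_⟩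
      rintro a w' rfl
      exact hw.1
    have key : ∀ w, Passes op w → (nodeChain D).CanReach ((nodeChain D).sat (okF op))
        ((nodeChain D).sat (acceptF op n)) (point D (main w)) →
        (nodeChain D).CanReach ((nodeChain D).sat (okF op))
        ((nodeChain D).sat (acceptF op n)) (point D (main [])) := by
      intro w
      induction w with
      | nil => exact fun _ h => h
      | cons a w ih =>
        intro hw h
        refine ih hw.2 (.step (hok w hw.2) ?_ h)
        rw [step_point, if_pos (by simp [succs])]
        have := weight_pos (main w)
        simpa [arcProb] using this
    exact key w hw (.base (sat_acceptF.2 ⟨hok w hw, w, rfl, hacc, hn⟩))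

theorem sat_haltF {op : Fin k → Op} {n : ℕ} {u : Node k} :
    Sat D (haltF op n) u ↔ u = main [] ∧ Accepts D op n := by
  have h1 : ∀ u, Sat D (.untl .gt zeroProb (okF op) (acceptF op n)) u ↔
      (nodeChain D).CanReach ((nodeChain D).sat (okF op)) ((nodeChain D).sat (acceptF op n))
        (point D u) := by
    intro u
    rw [← LabelledMarkovChain.pathMeasure_untilPaths_ne_zero_iff]
    have : Sat D (.untl .gt zeroProb (okF op) (acceptF op n)) u ↔
      ((nodeChain D).pathMeasure (point D u)).real (untilPaths
        ((nodeChain D).sat (okF op)) ((nodeChain D).sat (acceptF op n))) >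
          ((zeroProb : ℚ) : ℝ) := Iff.rfl
    rw [this, show ((zeroProb : ℚ) : ℝ) = 0 by simp [zeroProb], gt_iff_lt, measureReal_def,
      ENNReal.toReal_pos_iff, and_iff_left (measure_lt_top _ _), pos_iff_ne_zero]
  rw [haltF, sat_conj, sat_colourF, h1]
  constructor
  · rintro ⟨⟨⟩, h⟩
    exact ⟨rfl, canReach_iff.1 h⟩
  · rintro ⟨rfl, h⟩
    exact ⟨.root, canReach_iff.2 h⟩

end Automaton

open Automaton Nat.Partrec

/-! ## Undecidability -/

/-- A fixed automaton accepts exactly the codes of the programs that halt on the input `0`. -/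
theorem exists_halting_automaton : ∃ (k m : ℕ) (D : DFA (Fin k) (Fin m)) (op : Fin k → Op),
    ∀ c : Code, Accepts D op (Encodable.encode c) ↔ (c.eval 0).Dom := by
  -- The first argument is the bound `t` for `evaln`, which the program will guess; the value 0
  -- signals halting on the input 0 within this bound.
  let f : ℕ → ℕ → ℕ := fun t n => bif (Code.evaln t (Denumerable.ofNat Code n) 0).isSome then 0 else 1
  have hf : Primrec₂ f := by
    refine Primrec.cond (Primrec.option_isSome.comp ?_) (Primrec.const 0) (Primrec.const 1)
    exact Code.primrec_evaln.comp ((Primrec.fst.pair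
      ((Primrec.ofNat Code).comp Primrec.snd)).pair (Primrec.const 0))
  obtain ⟨e, he⟩ := Program.exists_program hf
  obtain ⟨k, op, m, D, hD⟩ := exists_dfa e
  refine ⟨k, m, D, op, fun c => ?_⟩
  have h1 : (c.eval 0).Dom ↔ ∃ t, f t (Encodable.encode c) = 0 := by
    have h0 : ∀ t, f t (Encodable.encode c) = 0 ↔ ∃ x, x ∈ Code.evaln t c 0 := by
      intro t
      simp only [f, Denumerable.ofNat_encode, Option.mem_def, ← Option.isSome_iff_exists]
      cases (Code.evaln t c 0).isSome <;> simp
    rw [Part.dom_iff_mem]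
    simp only [h0, Code.evaln_complete]
    exact exists_comm
  rw [h1, he]
  constructor
  · rintro ⟨w, hw, hacc, hn⟩
    -- Words of nodes have the last letter first, whereas the automaton and `Exec` read from the
    -- first letter on.
    refine ⟨counters op w, ⟨w.reverse.map op, (hD _).2 ⟨w.reverse, ?_, rfl⟩, ?_⟩, hn⟩
    · rw [DFA.mem_accepts, ← state_reverse, List.reverse_reverse]
      exact hacc
    · rw [exec_map_iff, List.reverse_reverse]
      exact ⟨hw, rfl⟩
  · rintro ⟨s, ⟨w, hw, hs⟩, hn⟩
    obtain ⟨v, hv, rfl⟩ := (hD w).1 hw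
    obtain ⟨h2, rfl⟩ := (exec_map_iff op v s).1 hs
    refine ⟨v.reverse, h2, ?_, hn⟩
    rw [state_reverse]
    exact hv

/-! ### Computability of the reduction. -/

theorem code_halfPow (n : ℕ) : (halfPow n).code = (1, 2 ^ (n + 1)) := by
  have h : 0 < (2 ^ (n + 1) : ℕ) := by positivity
  simp only [RatProb.code, halfPow]
  rw [Rat.inv_natCast_num_of_pos h, Rat.inv_natCast_den_of_pos h]
  rfl

theorem primrec_two_pow_succ : Primrec fun n : ℕ => 2 ^ (n + 1) := by
  have h : Primrec fun n : ℕ => Nat.rec (motive := fun _ => ℕ) 2 (fun _ x => x * 2) n :=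
    Primrec.nat_rec₁ 2 (Primrec.nat_mul.comp Primrec.snd (Primrec.const 2)).to₂
  refine h.of_eq fun n => ?_
  induction n with
  | zero => rfl
  | succ n ih => rw [pow_succ, ← ih]

theorem primrec_natPair {f g : ℕ → ℕ} (hf : Primrec f) (hg : Primrec g) :
    Primrec fun n => Nat.pair (f n) (g n) :=
  Primrec₂.natPair.comp hf hg

section PrimrecCode

variable {k : ℕ} {φ ψ : ℕ → PCTL (Fin k)} {ρ : ℕ → RatProb}

theorem primrec_code_neg (hφ : Primrec fun n => (φ n).code) :
    Primrec fun n => (PCTL.neg (φ n)).code := by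
  simp only [PCTL.code]
  exact primrec_natPair (Primrec.const 2) hφ

theorem primrec_code_conj (hφ : Primrec fun n => (φ n).code) (hψ : Primrec fun n => (ψ n).code) :
    Primrec fun n => (PCTL.conj (φ n) (ψ n)).code := by
  simp only [PCTL.code]
  exact primrec_natPair (Primrec.const 3) (primrec_natPair hφ hψ)

theorem primrec_code_next (c : Comparison) (hρ : Primrec fun n => (ρ n).code)
    (hφ : Primrec fun n => (φ n).code) : Primrec fun n => (PCTL.next c (ρ n) (φ n)).code := by
  simp only [PCTL.code]
  exact primrec_natPair (Primrec.const 4) (primrec_natPair (Primrec.const _) (primrec_natPair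
    (primrec_natPair (Primrec.fst.comp hρ) (Primrec.snd.comp hρ)) hφ))

theorem primrec_code_untl (c : Comparison) (hρ : Primrec fun n => (ρ n).code)
    (hφ : Primrec fun n => (φ n).code) (hψ : Primrec fun n => (ψ n).code) :
    Primrec fun n => (PCTL.untl c (ρ n) (φ n) (ψ n)).code := by
  simp only [PCTL.code]
  exact primrec_natPair (Primrec.const 5) (primrec_natPair (Primrec.const _) (primrec_natPair
    (primrec_natPair (Primrec.fst.comp hρ) (Primrec.snd.comp hρ)) (primrec_natPair hφ hψ)))

end PrimrecCode

theorem primrec_code_halfPow : Primrec fun n => (halfPow n).code := by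
  simp only [code_halfPow]
  exact (Primrec.const 1).pair primrec_two_pow_succ

/-- The number `n` enters the formula only through the threshold `halfPow n`; all other subformulae
are fixed and have constant codes. -/
theorem primrec_code_haltF {k : ℕ} (op : Fin k → Op) : Primrec fun n => (haltF op n).code :=
  primrec_code_conj (Primrec.const _) (primrec_code_untl _ (Primrec.const _) (Primrec.const _)
    (primrec_code_conj (Primrec.const _) (primrec_code_conj (Primrec.const _)
      (primrec_code_next _ (Primrec.const _) (primrec_code_conj (Primrec.const _)
        (primrec_code_conj
          (primrec_code_untl _ primrec_code_halfPow (Primrec.const _) (Primrec.const _))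
          (primrec_code_untl _ primrec_code_halfPow (Primrec.const _) (Primrec.const _))))))))

/-- A problem is undecidable if the halting problem can be reduced to it. -/
theorem not_decidableProblem {I α : Type} [Primcodable α] {code : I → α} {Q : I → Prop}
    (g : ℕ → I) (hg : Computable fun n => code (g n)) {p : Code → Prop}
    (hp : ¬ ComputablePred p) (hQ : ∀ c : Code, Q (g (Encodable.encode c)) ↔ p c) :
    ¬ DecidableProblem code Q := by
  classical
  rintro ⟨f, hf, h⟩
  refine hp ⟨Classical.decPred p, ?_⟩
  -- The algorithm is run only on codes of instances, where it is known to halt, so the composition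
  -- decides `p`.
  have hr : Partrec fun c : Code => f (code (g (Encodable.encode c))) :=
    hf.comp (hg.comp Computable.encode)
  refine hr.of_eq fun c => ?_
  obtain ⟨b, hb, hbQ⟩ := h (g (Encodable.encode c))
  rw [Part.eq_some_iff.2 hb]
  change _ = Part.some _
  congr 1
  rw [Bool.eq_iff_iff, hbQ, hQ, decide_eq_true_iff]

theorem root_mem_vertexSet {k m : ℕ} (D : DFA (Fin k) (Fin m)) :
    (Node.main (k := k) []).code ∈ vertexSet ((hrGrammar D).ruleGraph (hrGrammar D).start) :=
  ⟨_, List.mem_map_of_mem ((mem_startRule D).2 .main), by simp [Hyperarc.map, Hyperarc.verts]⟩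

/-- The rooted instance given by an automaton and an input. -/
noncomputable def haltInstance {k m : ℕ} (D : DFA (Fin k) (Fin m)) (op : Fin k → Op) (n : ℕ) :
    RootedInstance where
  P := grammar D
  φ := haltF op n
  x := (Node.main (k := k) []).code
  x_mem := root_mem_vertexSet D
  root_mem := (point D (.main [])).2

end ProbHypergraph

open ProbHypergraph Automaton

theorem mainTheorem4 :
    ¬ ProbHypergraph.DecidableProblem ProbHypergraph.Instance.code
        ProbHypergraph.Instance.Valid ∧
    ¬ ProbHypergraph.DecidableProblem ProbHypergraph.Instance.code
        ProbHypergraph.Instance.Satisfiable ∧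
    ¬ ProbHypergraph.DecidableProblem ProbHypergraph.RootedInstance.code
        ProbHypergraph.RootedInstance.Holds := by
  obtain ⟨k, m, D, op, hop⟩ := exists_halting_automaton
  have hcode := (primrec_code_haltF op).to_comp
  have hhalt := ComputablePred.halting_problem 0
  have hsat : ∀ v : (grammar D).Vertex, ∃ u, v = point D u :=
    fun v => ((point_bijective D).2 v).imp fun _ h => h.symm
  refine ⟨?_, ?_, ?_⟩
  -- `haltF` can hold only at the root, so its negation is valid exactly when the program does not
  -- halt; the reduction is from the complement of the halting problem.
  · refine not_decidableProblem (fun n => ⟨grammar D, .neg (haltF op n)⟩) ?_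
      (fun h => hhalt (h.not.of_eq fun c => not_not)) fun c => ?_
    · exact (Computable.const (grammar D).code).pair (primrec_code_neg (primrec_code_haltF op)).to_comp
    · constructor
      · intro h hc
        exact h (point D (.main [])) (sat_haltF.2 ⟨rfl, (hop c).2 hc⟩)
      · intro hc v hv
        obtain ⟨u, rfl⟩ := hsat v
        exact hc ((hop c).1 (sat_haltF.1 hv).2)
  · refine not_decidableProblem (fun n => ⟨grammar D, haltF op n⟩) ?_ hhalt fun c => ?_
    · exact (Computable.const (grammar D).code).pair hcode
    · constructor
      · rintro ⟨v, hv⟩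
        obtain ⟨u, rfl⟩ := hsat v
        exact (hop c).1 (sat_haltF.1 hv).2
      · intro hc
        exact ⟨point D (.main []), sat_haltF.2 ⟨rfl, (hop c).2 hc⟩⟩
  · refine not_decidableProblem (haltInstance D op) ?_ hhalt fun c => ?_
    · exact ((Computable.const (grammar D).code).pair hcode).pair
        (Computable.const (Node.main (k := k) []).code)
    · rw [← hop c]
      exact (sat_haltF (D := D) (u := .main [])).trans (and_iff_right rfl)
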